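/- Let $G$ be a compact Lie group with normalized Haar measure $\mu$ (written $dx$), and let $\hat G$ be the set of equivalence classes of continuous irreducible unitary representations of $G$. For each class fix a representative in matrix form $\xi:G\to U(d_\xi)$. For $f\in L^2(G)$ put $\hat f(\xi)=\int_G f(x)\,\xi(x)^*\,dx$. Let $\ell^2(\hat G)$ be the space of families $C=(C(\xi))_{[\xi]\in\hat G}$, $C(\xi)\in\mathbb{C}^{d_\xi\times d_\xi}$, with $\|C\|^2=\sum_{[\xi]\in\hat G} d_\xi\|C(\xi)\|_{HS}^2<\infty$, where $\|\cdot\|_{HS}$ is the Hilbert--Schmidt norm, let $C(G)$ be the space of continuous functions $G\to\mathbb{C}$ with the supremum norm, and write $(\mathfrak F^{-1}C)(x)=\sum_{[\xi]\in\hat G} d_\xi\,\mathrm{Tr}[C(\xi)\,\xi(x)]$. Let $T:L^2(G)\to L^2(G)$ be a bounded trace class operator, that is, $T$ is compact and its singular values (the eigenvalues of $|T|=(T^*T)^{1/2}$, counted with multiplicity) are summable; let $\|T\|_{S^1}$ denote their sum. Suppose that $T$ is the integral operator $Tf(x)=\int_G K(x,y)f(y)\,dy$ with kernel $K(x,y)=k(y^{-1}x)$,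 $k\in L^2(G)$, and that $K$ is symmetric, i.e. $K(x,y)=\overline{K(y,x)}$ for almost every $(x,y)$, and positive definite, i.e. $\sum_{i,j=1}^m c_i\overline{c_j}K(x_i,x_j)\ge 0$ for all $m\in\mathbb{N}$, $x_1,\dots,x_m\in G$ and $c_1,\dots,c_m\in\mathbb{C}$. Put $\sigma_T(\xi)=\hat k(\xi)$. Then each $\sigma_T(\xi)$ is positive semidefinite. Let $H_{\sigma_T}(\xi)$ be its positive semidefinite square root. The formula $$Q(C)=\mathfrak F^{-1}[H_{\sigma_T}C],\qquad Q(C)(x)=\sum_{[\xi]\in\hat G} d_\xi\,\mathrm{Tr}[H_{\sigma_T}(\xi)\,C(\xi)\,\xi(x)],$$ with the series converging unconditionally at every $x\in G$, defines a bounded linear operator $Q:\ell^2(\hat G)\to C(G)$, and $$\|Q\|_{op}^2=\sum_{[\xi]\in\hat G} d_\xi\,\mathrm{Tr}[\sigma_T(\xi)]=\|T\|_{S^1}.$$ Moreover, for every finite set $A\subseteq\hat G$, $$\|Q\,P_A\|_{op}^2=\sum_{[\xi]\in A} d_\xi\,\mathrm{Tr}[\sigma_T(\xi)],\qquad \|Q\,P_{A^{c}}\|_{op}^2=\sum_{[\xi]\in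 A^{c}} d_\xi\,\mathrm{Tr}[\sigma_T(\xi)],$$ where, for $B\subseteq\hat G$, $P_B$ is the operator on $\ell^2(\hat G)$ that keeps $C(\xi)$ for $[\xi]\in B$ and replaces it by $0$ for $[\xi]\notin B$. -/

import Mathlib

open MeasureTheory
open scoped ENNReal NNReal Manifold ContDiff ComplexOrder

/-! ### The unitary dual -/

/-- The action of a group on `ℂ^d` through unitary matrices, `g • v = ξ(g) v`. -/
noncomputable def unitaryMatrixRep {G : Type*} [Group G] {d : ℕ}
    (ξ : G →* Matrix.unitaryGroup (Fin d) ℂ) : Representation ℂ G (Fin d → ℂ) :=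
  ((Matrix.toLinAlgEquiv' : Matrix (Fin d) (Fin d) ℂ ≃ₐ[ℂ] _).toAlgHom.toMonoidHom.comp
    (Submonoid.subtype _)).comp ξ

theorem unitaryMatrixRep_apply {G : Type*} [Group G] {d : ℕ}
    (ξ : G →* Matrix.unitaryGroup (Fin d) ℂ) (g : G) (v : Fin d → ℂ) :
    unitaryMatrixRep ξ g v = ((ξ g : Matrix (Fin d) (Fin d) ℂ)).mulVec v := rfl

/-- A continuous irreducible unitary representation of `G` in matrix form (every continuous
irreducible unitary representation of a compact group is finite dimensional, and takes this form
once an orthonormal basis of its space is chosen). -/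
structure UnitaryIrrep (G : Type*) [Group G] [TopologicalSpace G] where
  /-- The dimension `d_ξ`. -/
  dim : ℕ
  /-- The unitary matrix-valued function `ξ`. -/
  toHom : G →* Matrix.unitaryGroup (Fin dim) ℂ
  continuous_toHom : Continuous toHom
  irreducible : (unitaryMatrixRep toHom).IsIrreducible

/-- The matrix `ξ(x)`. -/
def UnitaryIrrep.mat {G : Type*} [Group G] [TopologicalSpace G] (ξ : UnitaryIrrep G) (x : G) :
    Matrix (Fin ξ.dim) (Fin ξ.dim) ℂ := ξ.toHom x

/-- Equivalence of representations: existence of an invertible intertwining map. (For irreducible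
unitary representations this is the same as unitary equivalence.) -/
instance UnitaryIrrep.setoid (G : Type*) [Group G] [TopologicalSpace G] :
    Setoid (UnitaryIrrep G) where
  r ξ η := ∃ e : (Fin ξ.dim → ℂ) ≃ₗ[ℂ] (Fin η.dim → ℂ),
    ∀ (g : G) (v : Fin ξ.dim → ℂ), e ((ξ.mat g).mulVec v) = (η.mat g).mulVec (e v)
  iseqv :=
    { refl := fun ξ => ⟨LinearEquiv.refl ℂ _, fun _ _ => rfl⟩
      symm := by
        rintro ξ η ⟨e, he⟩
        exact ⟨e.symm, fun g v => by rw [LinearEquiv.symm_apply_eq, he, e.apply_symm_apply]⟩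
      trans := by
        rintro ξ η ζ ⟨e, he⟩ ⟨f, hf⟩
        exact ⟨e.trans f, fun g v => by simp only [LinearEquiv.trans_apply, he, hf]⟩ }

/-- The unitary dual `Ĝ`: equivalence classes of continuous irreducible unitary
representations. -/
abbrev UnitaryDual (G : Type*) [Group G] [TopologicalSpace G] : Type _ :=
  Quotient (UnitaryIrrep.setoid G)

/-! ### The space `ℓ²(Ĝ)` -/

/-- The `d × d` complex matrices with the norm `√d · ‖·‖_HS`, the block of `ℓ²(Ĝ)` at a
representation of dimension `d`. -/
def HSBlock (d : ℕ) : Type := Matrix (Fin d) (Fin d) ℂ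

namespace HSBlock

variable {d : ℕ}

instance : AddCommGroup (HSBlock d) := inferInstanceAs (AddCommGroup (Matrix (Fin d) (Fin d) ℂ))

noncomputable instance : Module ℂ (HSBlock d) :=
  inferInstanceAs (Module ℂ (Matrix (Fin d) (Fin d) ℂ))

/-- An element of the block, as a matrix. -/
noncomputable def mat : HSBlock d ≃ₗ[ℂ] Matrix (Fin d) (Fin d) ℂ := LinearEquiv.refl ℂ _

/-- The scaled list of the entries of a matrix, which carries the norm. -/
noncomputable def entries : HSBlock d →ₗ[ℂ] EuclideanSpace ℂ (Fin d × Fin d) where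
  toFun A := WithLp.toLp 2 fun p => ((Real.sqrt d : ℝ) : ℂ) * mat A p.1 p.2
  map_add' A B := by ext p; simp [mul_add]
  map_smul' c A := by ext p; simp [mul_left_comm]

theorem entries_injective : Function.Injective (entries : HSBlock d →ₗ[ℂ] _) := by
  intro A B h
  apply mat.injective
  ext i j
  have hd : ((Real.sqrt d : ℝ) : ℂ) ≠ 0 := by
    have : 0 < d := i.pos
    exact_mod_cast (Real.sqrt_pos.2 (by exact_mod_cast this)).ne'
  have h2 := congrArg (fun v => v.ofLp (i, j)) h
  exact mul_left_cancel₀ hd h2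

noncomputable instance : NormedAddCommGroup (HSBlock d) :=
  NormedAddCommGroup.induced (HSBlock d) (EuclideanSpace ℂ (Fin d × Fin d)) entries
    entries_injective

noncomputable instance : NormedSpace ℂ (HSBlock d) :=
  NormedSpace.induced ℂ (HSBlock d) (EuclideanSpace ℂ (Fin d × Fin d)) entries

/-- `‖A‖² = d · ‖A‖²_HS`. -/
theorem norm_sq (A : HSBlock d) : ‖A‖ ^ 2 = d * ∑ i, ∑ j, ‖mat A i j‖ ^ 2 := by
  change ‖entries A‖ ^ 2 = _
  rw [EuclideanSpace.norm_sq_eq, Fintype.sum_prod_type, Finset.mul_sum]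
  refine Finset.sum_congr rfl fun i _ => ?_
  rw [Finset.mul_sum]
  refine Finset.sum_congr rfl fun j _ => ?_
  simp [entries, mul_pow]

end HSBlock

section Dual

variable {G : Type*} [Group G] [TopologicalSpace G]

/-- `ℓ²(Ĝ)`, with respect to a choice of representatives: the families `C(ξ) ∈ ℂ^{d_ξ × d_ξ}`
with `‖C‖² = ∑ d_ξ ‖C(ξ)‖²_HS < ∞`. -/
abbrev EllTwoDual (rep : UnitaryDual G → UnitaryIrrep G) : Type _ :=
  lp (fun ξ : UnitaryDual G => HSBlock (rep ξ).dim) 2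

open Classical in
/-- The multiplier `P_A` on `ℓ²(Ĝ)`: it keeps `C(ξ)` for `ξ ∈ A` and puts `0` for `ξ ∉ A`. -/
noncomputable def multiplierProj (rep : UnitaryDual G → UnitaryIrrep G)
    (A : Set (UnitaryDual G)) : EllTwoDual rep →L[ℂ] EllTwoDual rep :=
  LinearMap.mkContinuous
    { toFun := fun C => ⟨fun ξ => if ξ ∈ A then C ξ else 0,
        (lp.memℓp C).mono' fun ξ => by split_ifs <;> simp⟩
      map_add' := fun C D => by
        ext ξ : 2
        change (if ξ ∈ A then C ξ + D ξ else 0) =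
          (if ξ ∈ A then C ξ else 0) + (if ξ ∈ A then D ξ else 0)
        split_ifs <;> simp
      map_smul' := fun c C => by
        ext ξ : 2
        by_cases h : ξ ∈ A <;> simp [h] }
    1 fun C => by
      rw [one_mul]
      refine lp.norm_mono (by norm_num) fun ξ => ?_
      change ‖(if ξ ∈ A then C ξ else 0 : HSBlock (rep ξ).dim)‖ ≤ ‖C ξ‖
      split_ifs <;> simp

open Classical in
theorem multiplierProj_apply (rep : UnitaryDual G → UnitaryIrrep G)
    (A : Set (UnitaryDual G)) (C : EllTwoDual rep) (ξ : UnitaryDual G) :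
    multiplierProj rep A C ξ = if ξ ∈ A then C ξ else 0 := rfl

/-- The Fourier coefficient `f̂(ξ) = ∫ f(x) ξ(x)^* dx`, that is `f̂(ξ)_{ij} = ⟨f, ξ_{ji}⟩`. -/
noncomputable def groupFourierCoeff [MeasurableSpace G] (μ : Measure G) (f : G → ℂ)
    (ξ : UnitaryIrrep G) : Matrix (Fin ξ.dim) (Fin ξ.dim) ℂ :=
  Matrix.of fun i j => ∫ x, f x * star (ξ.mat x j i) ∂μ

end Dual

/-! ### Kernels and trace class operators -/

/-- Positive definiteness of a kernel (`0 ≤ z` in `ℂ` means that `z` is real and `≥ 0`). -/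
def IsPosDefKernel {X : Type*} (K : X → X → ℂ) : Prop :=
  ∀ (n : ℕ) (x : Fin n → X) (c : Fin n → ℂ),
    0 ≤ ∑ i, ∑ j, c i * star (c j) * K (x i) (x j)

/-- Symmetry of a kernel, almost everywhere. -/
def IsSymmKernel {X : Type*} [MeasurableSpace X] (μ : Measure X) (K : X → X → ℂ) : Prop :=
  ∀ᵐ p ∂(μ.prod μ), K p.1 p.2 = star (K p.2 p.1)

section Schatten

variable {H : Type*} [NormedAddCommGroup H] [InnerProductSpace ℂ H] [CompleteSpace H]

/-- For compact `T`, the sum of the singular values of `T`, that is of the eigenvalues of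
`|T| = (T^* T)^{1/2}` counted with multiplicity: each `s ≥ 0` contributes `s` times the dimension
of its eigenspace. (For compact `T` the eigenspaces with `s > 0` are finite dimensional.) -/
noncomputable def schattenOneNorm (T : H →L[ℂ] H) : ℝ≥0∞ :=
  ∑' s : ℝ≥0, (s : ℝ≥0∞) *
    (Module.finrank ℂ (Module.End.eigenspace ((CFC.abs T : H →L[ℂ] H) : H →ₗ[ℂ] H)
      ((s : ℝ) : ℂ)) : ℝ≥0∞)

/-- Trace class operators (the class `S₁`): compact, with summable singular values. -/
def IsTraceClassOp (T : H →L[ℂ] H) : Prop :=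
  IsCompactOperator T ∧ schattenOneNorm T < ⊤

end Schatten

/-! Write `h(ξ)` for the square root of the symbol, regarded as an element of `ℓ²(Ĝ)`. The block
norm gives `‖h(ξ)‖² = d_ξ Tr[h(ξ)²] = d_ξ Tr[σ(ξ)]`. Cauchy–Schwarz in each block, with `ξ(x)`
unitary, and then over `Ĝ` bounds the series for `Q(C)(x)` by `‖h‖ ‖C‖`, uniformly in `x`. The
choice `C = h`, `x = 1` gives `Q(h)(1) = ‖h‖²`, so `‖Q‖ = ‖h‖` (`norm_synthesis`). A projection
`P_A` can be moved from `C` to `h`, so the truncated norms are instances of the same identity.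

It remains to see that the symbol is positive semidefinite and that `‖h‖² = ‖T‖_{S¹}`. Positive
definiteness of the kernel makes `T` a positive operator (`isPositive_of_isPosDefKernel`). On matrix
coefficients `T` acts by `k̂(ξ)` on the vector and fixes the row index (`convolution_apply_coeff`).
Positivity thus passes to `k̂(ξ)`, and by Schur orthogonality an eigenbasis of `k̂(ξ)` yields
orthonormal eigenvectors of `T`, each eigenvalue occurring once for each of the `d_ξ` rows.

No nonzero eigenvalue is missed (`eq_zero_of_eigenvector_of_orthogonal_coeff`). The eigenspace is
finite dimensional because `T` is compact, and translation invariant because `T` commutes with left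
translations. The part of it orthogonal to all coefficients is again invariant; were it nonzero, it
would contain a minimal invariant subspace, whose basis functions are coefficients of an irreducible
representation and hence orthogonal to themselves. The Peter–Weyl theorem is needed only in this
form. -/

set_option linter.unusedSectionVars false

/-! ### Haar measure on compact groups -/

section Haar

variable {G : Type*} [TopologicalSpace G] [Group G] [IsTopologicalGroup G] [CompactSpace G]
  [MeasurableSpace G] [BorelSpace G]

/-- Uniqueness of the Haar probability measure: a right translate of `μ` is again one. The same
argument, applied to the image under inversion, gives the next lemma. -/
theorem isMulRightInvariant_of_compactSpace (μ : Measure G) [μ.IsHaarMeasure]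
    [IsProbabilityMeasure μ] : μ.IsMulRightInvariant := by
  refine ⟨fun g => ?_⟩
  have : IsProbabilityMeasure (μ.map (· * g)) :=
    Measure.isProbabilityMeasure_map (measurable_mul_const g).aemeasurable
  exact Measure.isHaarMeasure_eq_of_isProbabilityMeasure _ _

theorem isInvInvariant_of_compactSpace (μ : Measure G) [μ.IsHaarMeasure]
    [IsProbabilityMeasure μ] : μ.IsInvInvariant := by
  have := isMulRightInvariant_of_compactSpace μ
  have : IsProbabilityMeasure μ.inv :=
    Measure.isProbabilityMeasure_map measurable_inv.aemeasurable
  have : μ.inv.IsHaarMeasure := { }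
  exact ⟨Measure.isHaarMeasure_eq_of_isProbabilityMeasure _ _⟩

end Haar

/-! ### Integrals of positive definite kernels -/

/-- Distinct coordinates of a product measure are independent, so their joint law is the product of
the marginals. -/
theorem measurePreserving_eval_pair {X : Type*} [MeasurableSpace X] (μ : Measure X)
    [IsProbabilityMeasure μ] {n : ℕ} {i j : Fin n} (hij : i ≠ j) :
    MeasurePreserving (fun x : Fin n → X => (x i, x j)) (Measure.pi fun _ => μ) (μ.prod μ) := by
  refine ⟨by fun_prop, ?_⟩
  have h := ProbabilityTheory.iIndepFun_pi (μ := fun _ : Fin n => μ)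
    (X := fun _ x => x) (fun _ => aemeasurable_id)
  have h2 := (ProbabilityTheory.indepFun_iff_map_prod_eq_prod_map_map
    (measurable_pi_apply i).aemeasurable (measurable_pi_apply j).aemeasurable).1
    (h.indepFun hij)
  rw [h2]
  have e (l : Fin n) : Measure.map (fun x : Fin n → X => x l) (Measure.pi fun _ => μ) = μ :=
    (measurePreserving_eval (fun _ : Fin n => μ) l).map_eq
  rw [e, e]

/-- If the sums over finite samples of an off-diagonal function `F` and a diagonal term `D` are
nonnegative, then so is the integral of `F`. -/
theorem integral_prod_nonneg_of_sum_nonneg {X : Type*} [MeasurableSpace X] (μ : Measure X)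
    [IsProbabilityMeasure μ] {F : X × X → ℂ} {D : X → ℂ} (hF : Integrable F (μ.prod μ))
    (hD : Integrable D μ)
    (h : ∀ (n : ℕ) (x : Fin n → X),
      0 ≤ ∑ i, ∑ j, if i = j then D (x i) else F (x i, x j)) :
    0 ≤ ∫ p, F p ∂(μ.prod μ) := by
  set I := ∫ p, F p ∂(μ.prod μ)
  set d := ∫ x, D x ∂μ
  have hi {n : ℕ} (i j : Fin n) : Integrable (fun x : Fin n → X =>
      if i = j then D (x i) else F (x i, x j)) (Measure.pi fun _ => μ) := by
    split_ifs with hij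
    · exact (measurePreserving_eval (fun _ : Fin n => μ) i).integrable_comp_of_integrable hD
    · exact (measurePreserving_eval_pair μ hij).integrable_comp_of_integrable hF
  have hv {n : ℕ} (i j : Fin n) : ∫ x : Fin n → X,
      (if i = j then D (x i) else F (x i, x j)) ∂(Measure.pi fun _ => μ) =
      if i = j then d else I := by
    split_ifs with hij
    · have e := (measurePreserving_eval (fun _ : Fin n => μ) i)
      have h1 := integral_map (μ := Measure.pi fun _ : Fin n => μ)
        e.measurable.aemeasurable (f := D) (by rw [e.map_eq]; exact hD.1)
      rw [e.map_eq] at h1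
      exact h1.symm
    · have e := measurePreserving_eval_pair μ hij
      have h1 := integral_map e.measurable.aemeasurable (f := F) (by rw [e.map_eq]; exact hF.1)
      rw [e.map_eq] at h1
      exact h1.symm
  -- Integrate the hypothesis over `N + 1` independent points: there are `N + 1` diagonal terms and
  -- `(N + 1) N` off-diagonal ones. Then cancel `N + 1`. As `N` grows the diagonal becomes
  -- negligible.
  have key (N : ℕ) : 0 ≤ d + N * I := by
    have h1 : 0 ≤ ∫ x : Fin (N + 1) → X, ∑ i, ∑ j,
        (if i = j then D (x i) else F (x i, x j)) ∂(Measure.pi fun _ => μ) :=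
      integral_nonneg (h (N + 1))
    rw [integral_finsetSum _ fun i _ => integrable_finsetSum _ fun j _ => hi i j] at h1
    simp_rw [integral_finsetSum _ fun j _ => hi _ j, hv] at h1
    have h2 (i : Fin (N + 1)) : ∑ j, (if i = j then d else I) = d + N * I := by
      rw [← Finset.add_sum_erase _ _ (Finset.mem_univ i), if_pos rfl]
      rw [Finset.sum_congr rfl fun j hj => if_neg (Finset.ne_of_mem_erase hj).symm]
      simp
    simp_rw [h2] at h1
    rw [Finset.sum_const, Finset.card_univ, Fintype.card_fin, nsmul_eq_mul] at h1
    rw [Complex.le_def] at h1 ⊢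
    have hp : (0 : ℝ) < N + 1 := by positivity
    have e : ((N + 1 : ℕ) : ℂ) = ((N + 1 : ℝ) : ℂ) := by push_cast; rfl
    rw [e, Complex.re_ofReal_mul, Complex.im_ofReal_mul] at h1
    refine ⟨?_, ?_⟩
    · exact (mul_nonneg_iff_of_pos_left hp).1 h1.1
    · have := h1.2.symm
      exact ((mul_eq_zero.1 this).resolve_left hp.ne').symm
  have hre (N : ℕ) : 0 ≤ d.re + N * I.re := by
    have := (Complex.le_def.1 (key N)).1
    rwa [Complex.add_re, ← Complex.ofReal_natCast, Complex.re_ofReal_mul] at this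
  have him (N : ℕ) : d.im + N * I.im = 0 := by
    have := (Complex.le_def.1 (key N)).2.symm
    rwa [Complex.add_im, ← Complex.ofReal_natCast, Complex.im_ofReal_mul] at this
  rw [Complex.le_def]
  constructor
  · by_contra hneg
    rw [Complex.zero_re, not_le] at hneg
    obtain ⟨N, hN⟩ := exists_nat_gt (d.re / (-I.re))
    rw [div_lt_iff₀ (by linarith)] at hN
    linarith [hre N]
  · have h0 := him 0
    have h1 := him 1
    simp only [Nat.cast_zero, zero_mul, add_zero] at h0
    simp only [Nat.cast_one, one_mul, h0, zero_add] at h1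
    exact h1.symm

section Convolution

variable {G : Type*} [TopologicalSpace G] [Group G] [IsTopologicalGroup G] [CompactSpace G]
  [T2Space G] [SecondCountableTopology G] [MeasurableSpace G] [BorelSpace G]
  {μ : Measure G} [μ.IsHaarMeasure] [IsProbabilityMeasure μ]

theorem integrable_comp_inv_mul {k : G → ℂ} (hk : Integrable k μ) :
    Integrable (fun p : G × G => k (p.2⁻¹ * p.1)) (μ.prod μ) :=
  ((measurePreserving_snd (μ := μ) (ν := μ)).comp
    (measurePreserving_prod_inv_mul_swap μ μ)).integrable_comp_of_integrable hk

theorem integrable_posDef_form {k : G → ℂ} (hk : Integrable k μ) (φ : C(G, ℂ)) :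
    Integrable (fun p : G × G => φ p.1 * star (φ p.2) * k (p.2⁻¹ * p.1)) (μ.prod μ) := by
  refine (integrable_comp_inv_mul hk).bdd_mul (c := ‖φ‖ * ‖φ‖)
    (by fun_prop) (Filter.Eventually.of_forall fun p => ?_)
  rw [norm_mul, norm_star]
  exact mul_le_mul (φ.norm_coe_le_norm _) (φ.norm_coe_le_norm _) (norm_nonneg _) (norm_nonneg _)

/-- Sampling the integral at random points uses pointwise definiteness, with weights `φ (x i)`. The
diagonal is null for the integral but not for the samples; on it the kernel is the constant `k 1`.
-/
theorem integral_posDef_form_nonneg {k : G → ℂ} (hk : Integrable k μ)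
    (hpos : IsPosDefKernel fun x y => k (y⁻¹ * x)) (φ : C(G, ℂ)) :
    0 ≤ ∫ p : G × G, φ p.1 * star (φ p.2) * k (p.2⁻¹ * p.1) ∂(μ.prod μ) := by
  have hc : Continuous fun x => φ x * star (φ x) * k 1 := by fun_prop
  refine integral_prod_nonneg_of_sum_nonneg μ (D := fun x => φ x * star (φ x) * k 1)
    (integrable_posDef_form hk φ) (hc.integrable_of_hasCompactSupport
      (HasCompactSupport.of_compactSpace _)) fun n x => ?_
  refine (hpos n x fun i => φ (x i)).trans_eq ?_
  refine Finset.sum_congr rfl fun i _ => Finset.sum_congr rfl fun j _ => ?_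
  split_ifs with h
  · subst h; simp
  · rfl

/-- Convolution operators with positive definite kernels are positive. -/
theorem isPositive_of_isPosDefKernel (T : Lp ℂ 2 μ →L[ℂ] Lp ℂ 2 μ) {k : G → ℂ}
    (hk : MemLp k 2 μ) (hT : ∀ f : Lp ℂ 2 μ, T f =ᵐ[μ] fun x => ∫ y, k (y⁻¹ * x) * f y ∂μ)
    (hpos : IsPosDefKernel fun x y => k (y⁻¹ * x)) : T.IsPositive := by
  have hk1 : Integrable k μ := hk.integrable (by norm_num)
  have main : ∀ f : Lp ℂ 2 μ, 0 ≤ inner ℂ (T f) f := by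
    intro f
    refine (ContinuousMap.toLp_denseRange ℂ μ ℂ (p := 2) (by norm_num)).induction_on f ?_ ?_
    · exact isClosed_le continuous_const (by fun_prop)
    · intro φ
      -- The form taken at `star φ` is the conjugate of `inner ℂ (T φ) φ`, the inner product being
      -- conjugate linear on the left.
      have h1 := integral_posDef_form_nonneg hk1 hpos (star φ)
      have h2 := star_nonneg_iff.2 h1
      refine h2.trans_eq ?_
      rw [integral_prod _ (integrable_posDef_form hk1 _), L2.inner_def, ← starRingEnd_apply,
        ← integral_conj]
      refine integral_congr_ae ?_
      filter_upwards [hT (ContinuousMap.toLp 2 μ ℂ φ), ContinuousMap.coeFn_toLp (p := 2) μ (𝕜 := ℂ) φ]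
        with x hx hx2
      rw [hx, RCLike.inner_apply, hx2]
      have h3 : ∫ y, k (y⁻¹ * x) * (ContinuousMap.toLp 2 μ ℂ φ) y ∂μ =
          ∫ y, k (y⁻¹ * x) * φ y ∂μ := by
        refine integral_congr_ae ?_
        filter_upwards [ContinuousMap.coeFn_toLp (p := 2) μ (𝕜 := ℂ) φ] with y hy
        rw [hy]
      have h4 : ∀ y, star φ x * star (star φ y) * k (y⁻¹ * x) =
          star (φ x) * (k (y⁻¹ * x) * φ y) := fun y => by
        simp only [ContinuousMap.star_apply, star_star]; ring
      simp_rw [h3, h4]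
      rw [integral_const_mul, map_mul]
      simp
  rw [ContinuousLinearMap.isPositive_iff_complex]
  intro f
  have := Complex.le_def.1 (main f)
  refine ⟨?_, this.1⟩
  apply Complex.ext
  · simp
  · simpa using this.2

end Convolution

/-! ### Matrix coefficients -/

namespace UnitaryIrrep

section Algebra

variable {G : Type*} [Group G] [TopologicalSpace G] (ξ η : UnitaryIrrep G)

theorem mat_mul (x y : G) : ξ.mat (x * y) = ξ.mat x * ξ.mat y := by
  simp [mat]

theorem mat_one : ξ.mat 1 = 1 := by
  simp [mat]

theorem mat_inv (x : G) : ξ.mat x⁻¹ = (ξ.mat x).conjTranspose := by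
  simp only [mat, map_inv]
  rfl

theorem mat_mul_conjTranspose (x : G) : ξ.mat x * (ξ.mat x).conjTranspose = 1 := by
  rw [← mat_inv, ← mat_mul, mul_inv_cancel, mat_one]

theorem continuous_mat : Continuous ξ.mat :=
  continuous_subtype_val.comp ξ.continuous_toHom

theorem continuous_mat_apply (i j : Fin ξ.dim) : Continuous fun x => ξ.mat x i j :=
  ξ.continuous_mat.matrix_elem i j

theorem dim_pos : 0 < ξ.dim := by
  have := ξ.irreducible.toNontrivial
  by_contra h
  have h0 : IsEmpty (Fin ξ.dim) := by
    rw [Nat.pos_iff_ne_zero, not_not] at h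
    rw [h]; infer_instance
  apply bot_ne_top (α := Subrepresentation (unitaryMatrixRep ξ.toHom))
  apply Subrepresentation.toSubmodule_injective
  exact Subsingleton.elim _ _

/-- The matrix coefficient `x ↦ (ξ(x) v)_i`. -/
def coeff (i : Fin ξ.dim) (v : Fin ξ.dim → ℂ) : C(G, ℂ) where
  toFun x := (ξ.mat x).mulVec v i
  continuous_toFun := by
    simp only [Matrix.mulVec, dotProduct]
    exact continuous_finsetSum _ fun j _ => (ξ.continuous_mat_apply i j).mul continuous_const

theorem coeff_apply (i : Fin ξ.dim) (v : Fin ξ.dim → ℂ) (x : G) :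
    ξ.coeff i v x = ∑ j, ξ.mat x i j * v j := rfl

theorem coeff_sum_smul {ι : Type*} (s : Finset ι) (i : Fin ξ.dim) (c : ι → ℂ)
    (v : ι → Fin ξ.dim → ℂ) :
    ξ.coeff i (∑ a ∈ s, c a • v a) = ∑ a ∈ s, c a • ξ.coeff i (v a) := by
  ext x
  rw [ContinuousMap.sum_apply]
  simp only [coeff_apply, ContinuousMap.smul_apply, Finset.sum_apply, Pi.smul_apply, smul_eq_mul,
    Finset.mul_sum]
  rw [Finset.sum_comm]
  exact Finset.sum_congr rfl fun a _ => Finset.sum_congr rfl fun j _ => by ring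

theorem coeff_smul (i : Fin ξ.dim) (c : ℂ) (v : Fin ξ.dim → ℂ) :
    ξ.coeff i (c • v) = c • ξ.coeff i v := by
  simpa using ξ.coeff_sum_smul {()} i (fun _ => c) (fun _ => v)

end Algebra

/-! ### Schur orthogonality by averaging over the group. -/

section Schur

variable {G : Type*} [TopologicalSpace G] [Group G] [IsTopologicalGroup G] [CompactSpace G]
  [MeasurableSpace G] [BorelSpace G] (μ : Measure G) [μ.IsHaarMeasure] [IsProbabilityMeasure μ]
  (ξ η : UnitaryIrrep G)

/-- The average of `ξ(x)⁻¹ B η(x)` over the group. -/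
noncomputable def average (B : Matrix (Fin ξ.dim) (Fin η.dim) ℂ) :
    Matrix (Fin ξ.dim) (Fin η.dim) ℂ :=
  Matrix.of fun j l => ∫ x, (ξ.mat x⁻¹ * B * η.mat x) j l ∂μ

theorem continuous_mat_inv_mul_mul (B : Matrix (Fin ξ.dim) (Fin η.dim) ℂ) :
    Continuous fun x => ξ.mat x⁻¹ * B * η.mat x :=
  ((ξ.continuous_mat.comp continuous_inv).matrix_mul continuous_const).matrix_mul η.continuous_mat

/-- The substitution `x ↦ x * g`, allowed by right invariance. -/
theorem average_mul_mat (B : Matrix (Fin ξ.dim) (Fin η.dim) ℂ) (g : G) :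
    average μ ξ η B * η.mat g = ξ.mat g * average μ ξ η B := by
  have := isMulRightInvariant_of_compactSpace μ
  have hint (j l) : Integrable (fun x => (ξ.mat x⁻¹ * B * η.mat x) j l) μ :=
    ((continuous_mat_inv_mul_mul ξ η B).matrix_elem j l).integrable_of_hasCompactSupport
      (HasCompactSupport.of_compactSpace _)
  ext j l
  have h1 : (average μ ξ η B * η.mat g) j l =
      ∫ x, (ξ.mat x⁻¹ * B * η.mat x * η.mat g) j l ∂μ := by
    simp only [Matrix.mul_apply (N := η.mat g), average, Matrix.of_apply]
    rw [integral_finsetSum _ fun m _ => (hint j m).mul_const _]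
    exact Finset.sum_congr rfl fun m _ => (integral_mul_const _ _).symm
  have h2 : (ξ.mat g * average μ ξ η B) j l =
      ∫ x, (ξ.mat g * (ξ.mat x⁻¹ * B * η.mat x)) j l ∂μ := by
    simp only [Matrix.mul_apply (M := ξ.mat g), average, Matrix.of_apply]
    rw [integral_finsetSum _ fun m _ => (hint m l).const_mul _]
    exact Finset.sum_congr rfl fun m _ => (integral_const_mul _ _).symm
  rw [h1, h2, ← integral_mul_right_eq_self (fun x => (ξ.mat g * (ξ.mat x⁻¹ * B * η.mat x)) j l) g]
  have h3 (x : G) : ξ.mat x⁻¹ * B * η.mat x * η.mat g =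
      ξ.mat g * (ξ.mat (x * g)⁻¹ * B * η.mat (x * g)) := by
    simp only [mat_mul, mul_inv_rev, ← Matrix.mul_assoc]
    rw [← mat_mul ξ g, mul_inv_cancel, mat_one, Matrix.one_mul]
  simp_rw [h3]

/-- The average as an intertwining map. -/
noncomputable def averageIntertwining (B : Matrix (Fin ξ.dim) (Fin η.dim) ℂ) :
    Representation.IntertwiningMap (unitaryMatrixRep η.toHom) (unitaryMatrixRep ξ.toHom) :=
  LinearMap.intertwiningMap_of_isIntertwiningMap _ _ (Matrix.mulVecLin (average μ ξ η B))
    fun g v => by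
      change (average μ ξ η B).mulVec ((η.mat g).mulVec v) =
        (ξ.mat g).mulVec ((average μ ξ η B).mulVec v)
      rw [Matrix.mulVec_mulVec, Matrix.mulVec_mulVec, average_mul_mat]

theorem average_eq_zero (h : ¬ η ≈ ξ) (B : Matrix (Fin ξ.dim) (Fin η.dim) ℂ) :
    average μ ξ η B = 0 := by
  have h1 := ξ.irreducible
  have h2 := η.irreducible
  rcases Representation.IsIrreducible.bijective_or_eq_zero (averageIntertwining μ ξ η B) with hb | h0
  · refine absurd ⟨LinearEquiv.ofBijective (averageIntertwining μ ξ η B).toLinearMap hb, ?_⟩ h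
    intro g v
    exact (averageIntertwining μ ξ η B).isIntertwining _ _ g v
  · have h3 : Matrix.mulVecLin (average μ ξ η B) = 0 :=
      congrArg Representation.IntertwiningMap.toLinearMap h0
    refine Matrix.ext_of_mulVec_single fun i => ?_
    rw [Matrix.zero_mulVec]
    exact LinearMap.congr_fun h3 (Pi.single i 1)

/-- By Schur's lemma over `ℂ` the average is a scalar matrix; conjugation preserves the trace, which
fixes the scalar. -/
theorem average_self (B : Matrix (Fin ξ.dim) (Fin ξ.dim) ℂ) :
    average μ ξ ξ B = (B.trace / ξ.dim) • (1 : Matrix (Fin ξ.dim) (Fin ξ.dim) ℂ) := by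
  have h1 := ξ.irreducible
  obtain ⟨c, hc⟩ := (Representation.IsIrreducible.algebraMap_intertwiningMap_bijective_of_isAlgClosed
    (k := ℂ) (ρ := unitaryMatrixRep ξ.toHom)).2 (averageIntertwining μ ξ ξ B)
  have h3 : average μ ξ ξ B = c • (1 : Matrix (Fin ξ.dim) (Fin ξ.dim) ℂ) := by
    refine Matrix.ext_of_mulVec_single fun i => ?_
    have := DFunLike.congr_fun hc (Pi.single i 1)
    rw [Matrix.smul_mulVec, Matrix.one_mulVec]
    exact this.symm
  have h4 : (average μ ξ ξ B).trace = B.trace := by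
    have hint (j) : Integrable (fun x => (ξ.mat x⁻¹ * B * ξ.mat x) j j) μ :=
      ((continuous_mat_inv_mul_mul ξ ξ B).matrix_elem j j).integrable_of_hasCompactSupport
        (HasCompactSupport.of_compactSpace _)
    calc (average μ ξ ξ B).trace = ∫ x, (ξ.mat x⁻¹ * B * ξ.mat x).trace ∂μ := by
          simp only [Matrix.trace, Matrix.diag, average, Matrix.of_apply]
          rw [integral_finsetSum _ fun j _ => hint j]
      _ = ∫ x, B.trace ∂μ := by
          refine integral_congr_ae (Filter.Eventually.of_forall fun x => ?_)
          simp only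
          rw [Matrix.trace_mul_comm, ← Matrix.mul_assoc, ← mat_mul, mul_inv_cancel, mat_one,
            Matrix.one_mul]
      _ = B.trace := by simp
  have h5 : (ξ.dim : ℂ) ≠ 0 := by exact_mod_cast ξ.dim_pos.ne'
  rw [h3, Matrix.trace_smul, Matrix.trace_one, Fintype.card_fin, smul_eq_mul] at h4
  rw [h3, ← h4, mul_div_cancel_right₀ _ h5]

/-- Averages of matrix units are exactly the inner products of matrix entries, so Schur's lemma
becomes orthogonality. -/
theorem average_single_apply (i j : Fin ξ.dim) (k l : Fin η.dim) :
    average μ ξ η (Matrix.single i k 1) j l = ∫ x, η.mat x k l * star (ξ.mat x i j) ∂μ := by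
  simp only [average, Matrix.of_apply, mat_inv]
  refine integral_congr_ae (Filter.Eventually.of_forall fun x => ?_)
  simp only [Matrix.mul_apply, Matrix.single_apply, Matrix.conjTranspose_apply]
  rw [Finset.sum_eq_single k (fun b _ hb => ?_) (by simp)]
  · simp [mul_comm]
  · simp [hb.symm]

/-- Schur orthogonality for inequivalent representations. -/
theorem integral_mat_mul_star_of_not_equiv (h : ¬ η ≈ ξ) (i j : Fin ξ.dim) (k l : Fin η.dim) :
    ∫ x, η.mat x k l * star (ξ.mat x i j) ∂μ = 0 := by
  rw [← average_single_apply, average_eq_zero μ ξ η h, Matrix.zero_apply]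

/-- Schur orthogonality for one representation. -/
theorem integral_mat_mul_star_self (i j k l : Fin ξ.dim) :
    ∫ x, ξ.mat x k l * star (ξ.mat x i j) ∂μ = if i = k ∧ j = l then 1 / (ξ.dim : ℂ) else 0 := by
  rw [← average_single_apply, average_self, Matrix.smul_apply, Matrix.one_apply]
  by_cases h : i = k
  · subst h; simp
  · simp [h, Matrix.trace_single_eq_of_ne]

theorem inner_coeff (f g : C(G, ℂ)) : inner ℂ (ContinuousMap.toLp 2 μ ℂ f)
    (ContinuousMap.toLp 2 μ ℂ g) = ∫ x, g x * star (f x) ∂μ :=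
  ContinuousMap.inner_toLp μ f g

theorem inner_coeff_eq (i : Fin ξ.dim) (v : Fin ξ.dim → ℂ) (k : Fin η.dim) (w : Fin η.dim → ℂ) :
    inner ℂ (ContinuousMap.toLp 2 μ ℂ (ξ.coeff i v)) (ContinuousMap.toLp 2 μ ℂ (η.coeff k w)) =
      ∑ j, ∑ l, (w l * star (v j)) * ∫ x, η.mat x k l * star (ξ.mat x i j) ∂μ := by
  have hint (j l) : Integrable (fun x => (w l * star (v j)) *
      (η.mat x k l * star (ξ.mat x i j))) μ :=
    (continuous_const.mul ((η.continuous_mat_apply k l).mul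
      (ξ.continuous_mat_apply i j).star)).integrable_of_hasCompactSupport
      (HasCompactSupport.of_compactSpace _)
  rw [inner_coeff]
  simp_rw [← integral_const_mul]
  simp_rw [← integral_finsetSum Finset.univ fun l _ => hint _ l]
  rw [← integral_finsetSum Finset.univ fun j _ => integrable_finsetSum _ fun l _ => hint j l]
  refine integral_congr_ae (Filter.Eventually.of_forall fun x => ?_)
  simp only [coeff_apply, star_sum, star_mul', Finset.mul_sum, Finset.sum_mul]
  exact Finset.sum_congr rfl fun j _ => Finset.sum_congr rfl fun l _ => by ring

theorem inner_coeff_of_not_equiv (h : ¬ η ≈ ξ) (i : Fin ξ.dim) (v : Fin ξ.dim → ℂ)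
    (k : Fin η.dim) (w : Fin η.dim → ℂ) :
    inner ℂ (ContinuousMap.toLp 2 μ ℂ (ξ.coeff i v)) (ContinuousMap.toLp 2 μ ℂ (η.coeff k w)) =
      0 := by
  rw [inner_coeff_eq]
  simp_rw [integral_mat_mul_star_of_not_equiv μ ξ η h, mul_zero, Finset.sum_const_zero]

theorem inner_coeff_self (i : Fin ξ.dim) (v : Fin ξ.dim → ℂ) (k : Fin ξ.dim)
    (w : Fin ξ.dim → ℂ) :
    inner ℂ (ContinuousMap.toLp 2 μ ℂ (ξ.coeff i v)) (ContinuousMap.toLp 2 μ ℂ (ξ.coeff k w)) =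
      if i = k then (star v ⬝ᵥ w) / ξ.dim else 0 := by
  rw [inner_coeff_eq]
  simp_rw [integral_mat_mul_star_self μ ξ]
  by_cases h : i = k
  · simp only [h, true_and, if_true, mul_ite, mul_zero, Finset.sum_ite_eq, Finset.mem_univ,
      dotProduct, Finset.sum_div, Pi.star_apply]
    exact Finset.sum_congr rfl fun j _ => by ring
  · simp [h]

end Schur

end UnitaryIrrep

/-! ### Convolution operators on matrix coefficients -/

section Convolution

variable {G : Type*} [TopologicalSpace G] [Group G] [IsTopologicalGroup G] [CompactSpace G]
  [MeasurableSpace G] [BorelSpace G] {μ : Measure G} [μ.IsHaarMeasure] [IsProbabilityMeasure μ]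

/-- Put `y = x z⁻¹`: since `ξ(x z⁻¹) = ξ(x) ξ(z)^*`, the integral over `z` collects into `k̂(ξ)`
acting on `v`. -/
theorem integral_mul_coeff (ξ : UnitaryIrrep G) {k : G → ℂ} (hk : Integrable k μ)
    (i : Fin ξ.dim) (v : Fin ξ.dim → ℂ) (x : G) :
    ∫ y, k (y⁻¹ * x) * ξ.coeff i v y ∂μ =
      ξ.coeff i ((groupFourierCoeff μ k ξ).mulVec v) x := by
  have := isInvInvariant_of_compactSpace μ
  have hint (l j) : Integrable (fun z => k z * star (ξ.mat z j l)) μ :=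
    hk.mul_bdd (c := 1) (ξ.continuous_mat_apply j l).star.aestronglyMeasurable
      (Filter.Eventually.of_forall fun z => by
        rw [norm_star]; exact entry_norm_bound_of_unitary (ξ.toHom z).2 j l)
  rw [← integral_div_left_eq_self _ μ x]
  have h1 (z : G) : k ((x / z)⁻¹ * x) * ξ.coeff i v (x / z) =
      ∑ l, ∑ j, (ξ.mat x i l * v j) * (k z * star (ξ.mat z j l)) := by
    have e1 : (x / z)⁻¹ * x = z := by rw [inv_div, div_mul_cancel]
    rw [e1, ξ.coeff_apply, div_eq_mul_inv, ξ.mat_mul, ξ.mat_inv]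
    simp only [Matrix.mul_apply, Matrix.conjTranspose_apply, Finset.mul_sum, Finset.sum_mul]
    rw [Finset.sum_comm]
    exact Finset.sum_congr rfl fun l _ => Finset.sum_congr rfl fun j _ => by ring
  simp_rw [h1]
  rw [integral_finsetSum _ fun l _ => integrable_finsetSum _ fun j _ => (hint l j).const_mul _]
  simp_rw [integral_finsetSum Finset.univ fun j _ => (hint _ j).const_mul _, integral_const_mul]
  rw [ξ.coeff_apply]
  simp only [Matrix.mulVec, dotProduct, groupFourierCoeff, Matrix.of_apply, Finset.mul_sum]
  exact Finset.sum_congr rfl fun l _ => Finset.sum_congr rfl fun j _ => by ring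

theorem convolution_apply_coeff {T : Lp ℂ 2 μ →L[ℂ] Lp ℂ 2 μ} {k : G → ℂ} (hk : MemLp k 2 μ)
    (hT : ∀ f : Lp ℂ 2 μ, T f =ᵐ[μ] fun x => ∫ y, k (y⁻¹ * x) * f y ∂μ)
    (ξ : UnitaryIrrep G) (i : Fin ξ.dim) (v : Fin ξ.dim → ℂ) :
    T (ContinuousMap.toLp 2 μ ℂ (ξ.coeff i v)) =
      ContinuousMap.toLp 2 μ ℂ (ξ.coeff i ((groupFourierCoeff μ k ξ).mulVec v)) := by
  refine Lp.ext ?_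
  filter_upwards [hT (ContinuousMap.toLp 2 μ ℂ (ξ.coeff i v)), ContinuousMap.coeFn_toLp (p := 2) μ
    (𝕜 := ℂ) (ξ.coeff i ((groupFourierCoeff μ k ξ).mulVec v))] with x hx hx2
  rw [hx, hx2, ← integral_mul_coeff ξ (hk.integrable (by norm_num))]
  refine integral_congr_ae ?_
  filter_upwards [ContinuousMap.coeFn_toLp (p := 2) μ (𝕜 := ℂ) (ξ.coeff i v)] with y hy
  rw [hy]

/-- For a fixed row, here row `0`, the map `v ↦ ξ.coeff 0 v` is an isometry of `ℂ^d` into `L²(G)` up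
to the factor `1/√d`, and it carries `k̂(ξ)` to `T`. -/
theorem posSemidef_groupFourierCoeff {T : Lp ℂ 2 μ →L[ℂ] Lp ℂ 2 μ} (hTpos : T.IsPositive)
    {k : G → ℂ} (hk : MemLp k 2 μ)
    (hT : ∀ f : Lp ℂ 2 μ, T f =ᵐ[μ] fun x => ∫ y, k (y⁻¹ * x) * f y ∂μ)
    (ξ : UnitaryIrrep G) : (groupFourierCoeff μ k ξ).PosSemidef := by
  have hd : (0 : ℂ) < ξ.dim := by exact_mod_cast ξ.dim_pos
  have hherm : (groupFourierCoeff μ k ξ).IsHermitian := by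
    ext a b
    have h1 := hTpos.isSymmetric (ContinuousMap.toLp 2 μ ℂ (ξ.coeff ⟨0, ξ.dim_pos⟩ (Pi.single a 1)))
      (ContinuousMap.toLp 2 μ ℂ (ξ.coeff ⟨0, ξ.dim_pos⟩ (Pi.single b 1)))
    simp only [ContinuousLinearMap.coe_coe] at h1
    rw [convolution_apply_coeff hk hT, convolution_apply_coeff hk hT, ξ.inner_coeff_self μ,
      ξ.inner_coeff_self μ, if_pos rfl, if_pos rfl, div_left_inj' hd.ne'] at h1
    simpa using h1
  have key (v : Fin ξ.dim → ℂ) : 0 ≤ star v ⬝ᵥ (groupFourierCoeff μ k ξ).mulVec v := by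
    have h1 := hTpos.inner_nonneg_right (ContinuousMap.toLp 2 μ ℂ (ξ.coeff ⟨0, ξ.dim_pos⟩ v))
    rw [convolution_apply_coeff hk hT, ξ.inner_coeff_self μ, if_pos rfl] at h1
    have h2 := mul_nonneg hd.le h1
    rwa [mul_div_cancel₀ _ hd.ne'] at h2
  exact Matrix.PosSemidef.of_dotProduct_mulVec_nonneg hherm key

end Convolution

/-! ### Left translations on `L²(G)` -/

section Translation

variable {G : Type*} [TopologicalSpace G] [Group G] [IsTopologicalGroup G] [CompactSpace G]
  [T2Space G] [SecondCountableTopology G] [MeasurableSpace G] [BorelSpace G]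
  (μ : Measure G) [μ.IsHaarMeasure] [IsProbabilityMeasure μ]

/-- Left translation `f ↦ f(g⁻¹ ·)` on `L²(G)`. -/
noncomputable def leftTranslation (g : G) : Lp ℂ 2 μ →ₗᵢ[ℂ] Lp ℂ 2 μ where
  toFun f := DomMulAct.mk g⁻¹ • f
  map_add' f h := DomMulAct.smul_Lp_add _ f h
  map_smul' c f := smul_comm _ c f
  norm_map' f := DomMulAct.norm_smul_Lp _ f

variable {μ}

theorem leftTranslation_ae_eq (g : G) (f : Lp ℂ 2 μ) :
    leftTranslation μ g f =ᵐ[μ] fun x => f (g⁻¹ * x) :=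
  DomMulAct.smul_Lp_ae_eq (DomMulAct.mk g⁻¹) f

theorem leftTranslation_mul (g h : G) (f : Lp ℂ 2 μ) :
    leftTranslation μ (g * h) f = leftTranslation μ g (leftTranslation μ h f) := by
  change DomMulAct.mk (g * h)⁻¹ • f = DomMulAct.mk g⁻¹ • DomMulAct.mk h⁻¹ • f
  rw [smul_smul, ← DomMulAct.mk_mul, mul_inv_rev]

theorem leftTranslation_one (f : Lp ℂ 2 μ) : leftTranslation μ 1 f = f := by
  change DomMulAct.mk (1 : G)⁻¹ • f = f
  rw [inv_one, DomMulAct.mk_one, one_smul]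

theorem continuous_leftTranslation (f : Lp ℂ 2 μ) :
    Continuous fun g => leftTranslation μ g f := by
  have : Continuous fun g : G => DomMulAct.mk g⁻¹ :=
    DomMulAct.continuous_mk.comp continuous_inv
  have _ : Fact ((2 : ℝ≥0∞) ≠ ⊤) := ⟨by norm_num⟩
  exact this.smul continuous_const

theorem inner_leftTranslation_left (g : G) (f h : Lp ℂ 2 μ) :
    inner ℂ (leftTranslation μ g f) h = inner ℂ f (leftTranslation μ g⁻¹ h) := by
  rw [← (leftTranslation μ g).inner_map_map f, ← leftTranslation_mul, mul_inv_cancel,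
    leftTranslation_one]

theorem leftTranslation_toLp_coeff (ξ : UnitaryIrrep G) (i : Fin ξ.dim) (v : Fin ξ.dim → ℂ)
    (g : G) : leftTranslation μ g (ContinuousMap.toLp 2 μ ℂ (ξ.coeff i v)) =
      ∑ l, ξ.mat g⁻¹ i l • ContinuousMap.toLp 2 μ ℂ (ξ.coeff l v) := by
  have h1 : ∑ l, ξ.mat g⁻¹ i l • ContinuousMap.toLp 2 μ ℂ (ξ.coeff l v) =
      ContinuousMap.toLp 2 μ ℂ (∑ l, ξ.mat g⁻¹ i l • ξ.coeff l v) := by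
    simp only [map_sum, map_smul]
  rw [h1]
  refine Lp.ext ?_
  filter_upwards [leftTranslation_ae_eq g (ContinuousMap.toLp 2 μ ℂ (ξ.coeff i v)),
    ContinuousMap.coeFn_toLp (p := 2) μ (𝕜 := ℂ) (∑ l, ξ.mat g⁻¹ i l • ξ.coeff l v),
    (measurePreserving_mul_left μ g⁻¹).quasiMeasurePreserving.ae
      (ContinuousMap.coeFn_toLp (p := 2) μ (𝕜 := ℂ) (ξ.coeff i v))] with x h1 h2 h3
  rw [h1, h2, h3, ContinuousMap.sum_apply]
  simp only [ContinuousMap.smul_apply, UnitaryIrrep.coeff_apply, smul_eq_mul]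
  rw [ξ.mat_mul]
  simp only [Matrix.mul_apply, Finset.sum_mul, Finset.mul_sum]
  rw [Finset.sum_comm]
  exact Finset.sum_congr rfl fun l _ => Finset.sum_congr rfl fun j _ => by ring

/-- The kernel depends only on `y⁻¹ x`, which does not change when `x` and `y` are both multiplied
on the left by the same element. -/
theorem convolution_leftTranslation {T : Lp ℂ 2 μ →L[ℂ] Lp ℂ 2 μ} {k : G → ℂ}
    (hT : ∀ f : Lp ℂ 2 μ, T f =ᵐ[μ] fun x => ∫ y, k (y⁻¹ * x) * f y ∂μ) (g : G)
    (f : Lp ℂ 2 μ) : T (leftTranslation μ g f) = leftTranslation μ g (T f) := by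
  refine Lp.ext ?_
  filter_upwards [hT (leftTranslation μ g f), leftTranslation_ae_eq g (T f),
    (measurePreserving_mul_left μ g⁻¹).quasiMeasurePreserving.ae (hT f)] with x h1 h2 h3
  rw [h1, h2, h3, ← integral_mul_left_eq_self (fun y => k (y⁻¹ * (g⁻¹ * x)) * f y) g⁻¹]
  refine integral_congr_ae ?_
  filter_upwards [leftTranslation_ae_eq g f] with y hy
  rw [hy]
  congr 2
  group

end Translation

/-! ### Finite-dimensional translation-invariant subspaces of `L²(G)` -/

section Invariant

variable {G : Type*} [TopologicalSpace G] [Group G] [IsTopologicalGroup G] [CompactSpace G]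
  [T2Space G] [SecondCountableTopology G] [MeasurableSpace G] [BorelSpace G]
  {μ : Measure G} [μ.IsHaarMeasure] [IsProbabilityMeasure μ]

/-- Invariance of a subspace of `L²(G)` under left translations. -/
def IsTranslationInvariant (W : Submodule ℂ (Lp ℂ 2 μ)) : Prop :=
  ∀ (g : G), ∀ f ∈ W, leftTranslation μ g f ∈ W

theorem exists_minimal_translationInvariant (W : Submodule ℂ (Lp ℂ 2 μ))
    [FiniteDimensional ℂ W] (hW : IsTranslationInvariant W) (h0 : W ≠ ⊥) :
    ∃ V ≤ W, IsTranslationInvariant V ∧ V ≠ ⊥ ∧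
      ∀ U ≤ V, IsTranslationInvariant U → U = ⊥ ∨ U = V := by
  let S : Set ℕ := {n | ∃ V ≤ W, IsTranslationInvariant V ∧ V ≠ ⊥ ∧ Module.finrank ℂ V = n}
  have hS : S.Nonempty := ⟨_, W, le_rfl, hW, h0, rfl⟩
  obtain ⟨V, hVW, hV, hV0, hn⟩ := Nat.sInf_mem hS
  refine ⟨V, hVW, hV, hV0, fun U hU hUi => or_iff_not_imp_left.2 fun hU0 => ?_⟩
  have : FiniteDimensional ℂ V := Submodule.finiteDimensional_of_le hVW
  refine Submodule.eq_of_le_of_finrank_le hU ?_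
  rw [hn]
  exact Nat.sInf_le ⟨U, hU.trans hVW, hUi, hU0, rfl⟩

/-! ### The representation carried by an invariant subspace. -/

section MatrixForm

variable {d : ℕ} {V : Submodule ℂ (Lp ℂ 2 μ)}

/-- The conjugate of the matrix of a left translation in an orthonormal basis of an invariant
subspace. -/
noncomputable def translationMatrix (b : OrthonormalBasis (Fin d) ℂ V) (g : G) : Matrix (Fin d) (Fin d) ℂ :=
  Matrix.of fun i j => inner ℂ (leftTranslation μ g (b j : Lp ℂ 2 μ)) (b i : Lp ℂ 2 μ)

/-- The conjugate appears because `translationMatrix` is conjugated; with that choice the basis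
functions turn out to be coefficients of `translationMatrix` itself and not of its conjugate. -/
theorem leftTranslation_basis (hV : IsTranslationInvariant V)
    (b : OrthonormalBasis (Fin d) ℂ V) (g : G) (j : Fin d) :
    leftTranslation μ g (b j : Lp ℂ 2 μ) =
      ∑ i, star (translationMatrix b g i j) • (b i : Lp ℂ 2 μ) := by
  have := congrArg Subtype.val (b.sum_repr' ⟨leftTranslation μ g (b j), hV g _ (b j).2⟩)
  simp only [Submodule.coe_sum, Submodule.coe_smul, Submodule.coe_inner] at this
  rw [← this]
  refine Finset.sum_congr rfl fun i _ => ?_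
  simp [translationMatrix]

theorem translationMatrix_one (b : OrthonormalBasis (Fin d) ℂ V) :
    translationMatrix b 1 = 1 := by
  ext i j
  simp only [translationMatrix, Matrix.of_apply, leftTranslation_one]
  rw [← Submodule.coe_inner, b.inner_eq_ite, Matrix.one_apply]
  simp only [eq_comm]

theorem translationMatrix_mul (hV : IsTranslationInvariant V) (b : OrthonormalBasis (Fin d) ℂ V)
    (g h : G) : translationMatrix b (g * h) = translationMatrix b g * translationMatrix b h := by
  ext i j
  rw [Matrix.mul_apply]
  change inner ℂ (leftTranslation μ (g * h) (b j : Lp ℂ 2 μ)) (b i : Lp ℂ 2 μ) = _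
  rw [leftTranslation_mul, leftTranslation_basis hV b h, map_sum, sum_inner]
  refine Finset.sum_congr rfl fun l _ => ?_
  rw [map_smul, inner_smul_left, ← starRingEnd_apply, starRingEnd_self_apply, mul_comm]
  rfl

theorem translationMatrix_conjTranspose (b : OrthonormalBasis (Fin d) ℂ V) (g : G) :
    (translationMatrix b g).conjTranspose = translationMatrix b g⁻¹ := by
  ext i j
  simp only [translationMatrix, Matrix.of_apply, Matrix.conjTranspose_apply]
  rw [inner_leftTranslation_left g⁻¹, inv_inv]
  exact inner_conj_symm _ _

/-- The conjugate of the representation by left translations on an invariant subspace, in matrix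
form. -/
noncomputable def translationHom (hV : IsTranslationInvariant V)
    (b : OrthonormalBasis (Fin d) ℂ V) : G →* Matrix.unitaryGroup (Fin d) ℂ where
  toFun g := ⟨translationMatrix b g, by
    rw [Matrix.mem_unitaryGroup_iff, Matrix.star_eq_conjTranspose, translationMatrix_conjTranspose,
      ← translationMatrix_mul hV, mul_inv_cancel, translationMatrix_one]⟩
  map_one' := Subtype.ext (translationMatrix_one b)
  map_mul' g h := Subtype.ext (translationMatrix_mul hV b g h)

theorem continuous_translationHom (hV : IsTranslationInvariant V)
    (b : OrthonormalBasis (Fin d) ℂ V) : Continuous (translationHom hV b) := by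
  refine Continuous.subtype_mk (continuous_matrix fun i j => ?_) _
  exact (continuous_leftTranslation _).inner continuous_const

/-- The conjugate linear coordinates on the span of an orthonormal basis. -/
noncomputable def conjCombination (b : OrthonormalBasis (Fin d) ℂ V) :
    (Fin d → ℂ) →ₛₗ[starRingEnd ℂ] Lp ℂ 2 μ where
  toFun c := ∑ j, star (c j) • (b j : Lp ℂ 2 μ)
  map_add' c e := by simp [add_smul, Finset.sum_add_distrib]
  map_smul' a c := by simp [Finset.smul_sum, mul_smul]

theorem conjCombination_mem (b : OrthonormalBasis (Fin d) ℂ V) (c : Fin d → ℂ) :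
    conjCombination b c ∈ V := by
  change ∑ j, star (c j) • (b j : Lp ℂ 2 μ) ∈ V
  exact Submodule.sum_mem V fun j _ => V.smul_mem _ (b j).2

theorem exists_conjCombination_eq (b : OrthonormalBasis (Fin d) ℂ V) {f : Lp ℂ 2 μ}
    (hf : f ∈ V) : ∃ c, conjCombination b c = f := by
  refine ⟨fun j => star (inner ℂ (b j) (⟨f, hf⟩ : V)), ?_⟩
  have := congrArg Subtype.val (b.sum_repr' ⟨f, hf⟩)
  simp only [Submodule.coe_sum, Submodule.coe_smul] at this
  simpa only [conjCombination, LinearMap.coe_mk, AddHom.coe_mk, star_star] using this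

theorem conjCombination_injective (b : OrthonormalBasis (Fin d) ℂ V) :
    Function.Injective (conjCombination b) := by
  refine (injective_iff_map_eq_zero _).2 fun c hc => ?_
  have h1 : ∑ j, star (c j) • b j = 0 := by
    apply Subtype.val_injective
    simp only [Submodule.coe_sum, Submodule.coe_smul, Submodule.coe_zero]
    exact hc
  have h2 := Fintype.linearIndependent_iff.1 b.orthonormal.linearIndependent _ h1
  ext j
  simpa using h2 j

theorem leftTranslation_conjCombination (hV : IsTranslationInvariant V)
    (b : OrthonormalBasis (Fin d) ℂ V) (g : G) (c : Fin d → ℂ) :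
    leftTranslation μ g (conjCombination b c) =
      conjCombination b ((translationMatrix b g).mulVec c) := by
  simp only [conjCombination, LinearMap.coe_mk, AddHom.coe_mk, map_sum, map_smul,
    leftTranslation_basis hV b g, Finset.smul_sum, Matrix.mulVec, dotProduct, star_sum, star_mul',
    Finset.sum_smul, smul_smul]
  rw [Finset.sum_comm]
  simp only [mul_comm]

/-- The injective conjugate linear map `conjCombination b` intertwines the matrices with
translations, so it sends subrepresentations to invariant subspaces of `V`, where minimality
applies. -/
theorem isIrreducible_translationHom (hV : IsTranslationInvariant V)
    (b : OrthonormalBasis (Fin d) ℂ V) (hV0 : V ≠ ⊥)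
    (hmin : ∀ U ≤ V, IsTranslationInvariant U → U = ⊥ ∨ U = V) :
    (unitaryMatrixRep (translationHom hV b)).IsIrreducible := by
  have hne : Nontrivial (Subrepresentation (unitaryMatrixRep (translationHom hV b))) := by
    refine ⟨⊥, ⊤, fun h => hV0 ?_⟩
    refine (Submodule.eq_bot_iff _).2 fun f hf => ?_
    obtain ⟨c, rfl⟩ := exists_conjCombination_eq b hf
    have h1 : (⊥ : Submodule ℂ (Fin d → ℂ)) = ⊤ := congrArg Subrepresentation.toSubmodule h
    have h2 : c ∈ (⊥ : Submodule ℂ (Fin d → ℂ)) := h1 ▸ Submodule.mem_top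
    rw [(Submodule.mem_bot ℂ).1 h2, map_zero]
  refine { eq_bot_or_eq_top := fun S => ?_ }
  have hinv : IsTranslationInvariant (S.toSubmodule.map (conjCombination b)) := by
    rintro g _ ⟨c, hc, rfl⟩
    exact ⟨_, S.apply_mem_toSubmodule g hc, (leftTranslation_conjCombination hV b g c).symm⟩
  rcases hmin _ (by rintro _ ⟨c, -, rfl⟩; exact conjCombination_mem b c) hinv with h | h
  · left
    apply Subrepresentation.toSubmodule_injective
    refine (Submodule.eq_bot_iff _).2 fun c hc => ?_
    have h1 : conjCombination b c ∈ S.toSubmodule.map (conjCombination b) := ⟨c, hc, rfl⟩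
    rw [h, Submodule.mem_bot] at h1
    exact conjCombination_injective b (h1.trans (map_zero _).symm)
  · right
    apply Subrepresentation.toSubmodule_injective
    refine (Submodule.eq_top_iff'.2 fun c => ?_)
    have h1 : conjCombination b c ∈ S.toSubmodule.map (conjCombination b) := by
      rw [h]; exact conjCombination_mem b c
    obtain ⟨e, he, hec⟩ := h1
    rw [← conjCombination_injective b hec]
    exact he

/-- The irreducible representation attached to a minimal invariant subspace. -/
noncomputable def translationIrrep (hV : IsTranslationInvariant V)
    (b : OrthonormalBasis (Fin d) ℂ V) (hV0 : V ≠ ⊥)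
    (hmin : ∀ U ≤ V, IsTranslationInvariant U → U = ⊥ ∨ U = V) : UnitaryIrrep G where
  dim := d
  toHom := translationHom hV b
  continuous_toHom := continuous_translationHom hV b
  irreducible := isIrreducible_translationHom hV b hV0 hmin

/-- The elements of an orthonormal basis of an invariant subspace are combinations of the
coefficients of the translation matrices. -/
theorem exists_ae_eq_sum_translationMatrix (hV : IsTranslationInvariant V)
    (b : OrthonormalBasis (Fin d) ℂ V) (j : Fin d) :
    ∃ c : Fin d → ℂ, (b j : Lp ℂ 2 μ) =ᵐ[μ] fun h => (translationMatrix b h).mulVec c j := by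
  have hmeas (i : Fin d) : StronglyMeasurable (b i : Lp ℂ 2 μ) := Lp.stronglyMeasurable _
  have hcont (i : Fin d) : Continuous fun g => translationMatrix b g i j :=
    (continuous_leftTranslation _).inner continuous_const
  have h1 (g : G) : ∀ᵐ x ∂μ, (b j : Lp ℂ 2 μ) (g⁻¹ * x) =
      ∑ i, star (translationMatrix b g i j) * (b i : Lp ℂ 2 μ) x := by
    have e := leftTranslation_basis hV b g j
    filter_upwards [leftTranslation_ae_eq g (b j : Lp ℂ 2 μ),
      Lp.coeFn_finsetSum Finset.univ fun i =>
        star (translationMatrix b g i j) • (b i : Lp ℂ 2 μ),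
      Filter.eventually_all.2 fun i =>
        Lp.coeFn_smul (star (translationMatrix b g i j)) (b i : Lp ℂ 2 μ)] with x h2 h3 h4
    rw [← h2, e, h3]
    rw [Finset.sum_apply]
    exact Finset.sum_congr rfl fun i _ => h4 i
  have hset : MeasurableSet {p : G × G | (b j : Lp ℂ 2 μ) (p.1⁻¹ * p.2) =
      ∑ i, star (translationMatrix b p.1 i j) * (b i : Lp ℂ 2 μ) p.2} := by
    refine measurableSet_eq_fun ?_ ?_
    · exact (hmeas j).measurable.comp (by fun_prop)
    · refine Finset.measurable_fun_sum _ fun i _ => Measurable.mul ?_ ?_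
      · exact ((hcont i).star.measurable).comp measurable_fst
      · exact (hmeas i).measurable.comp measurable_snd
  -- The expansion holds for each `g` at almost every `x`. Exchanging the quantifiers by Fubini
  -- allows one `x` to be fixed; with `g = x h⁻¹` the left side becomes the basis function at `h`.
  have h2 : ∀ᵐ x ∂μ, ∀ᵐ g ∂μ, (b j : Lp ℂ 2 μ) (g⁻¹ * x) =
      ∑ i, star (translationMatrix b g i j) * (b i : Lp ℂ 2 μ) x :=
    (Measure.ae_ae_comm hset).1 (Filter.Eventually.of_forall h1)
  obtain ⟨x, hx⟩ := h2.exists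
  have := isInvInvariant_of_compactSpace μ
  have h3 := (Measure.measurePreserving_div_left μ x).quasiMeasurePreserving.ae hx
  refine ⟨fun l => ∑ i, star (translationMatrix b x i l) * (b i : Lp ℂ 2 μ) x, ?_⟩
  filter_upwards [h3] with h hh
  rw [inv_div, div_mul_cancel] at hh
  rw [hh]
  have e (i : Fin d) : star (translationMatrix b (x / h) i j) =
      ∑ l, star (translationMatrix b x i l) * translationMatrix b h j l := by
    rw [div_eq_mul_inv, translationMatrix_mul hV, ← translationMatrix_conjTranspose]
    simp [Matrix.mul_apply]
  simp_rw [e, Matrix.mulVec, dotProduct, Finset.mul_sum, Finset.sum_mul]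
  rw [Finset.sum_comm]
  exact Finset.sum_congr rfl fun l _ => Finset.sum_congr rfl fun i _ => by ring

end MatrixForm

/-- A finite-dimensional translation-invariant subspace of `L²(G)` that is orthogonal to the
coefficients of all irreducible representations is trivial. -/
theorem IsTranslationInvariant.eq_bot_of_orthogonal_coeff {W : Submodule ℂ (Lp ℂ 2 μ)}
    [FiniteDimensional ℂ W] (hW : IsTranslationInvariant W)
    (horth : ∀ (ξ : UnitaryIrrep G) (i : Fin ξ.dim) (v : Fin ξ.dim → ℂ), ∀ f ∈ W,
      inner ℂ (ContinuousMap.toLp 2 μ ℂ (ξ.coeff i v)) f = 0) : W = ⊥ := by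
  by_contra h0
  obtain ⟨V, hVW, hV, hV0, hmin⟩ := exists_minimal_translationInvariant W hW h0
  have : FiniteDimensional ℂ V := Submodule.finiteDimensional_of_le hVW
  let b := stdOrthonormalBasis ℂ V
  have hd : 0 < Module.finrank ℂ V := by
    have : Nontrivial V := Submodule.nontrivial_iff_ne_bot.2 hV0
    exact Module.finrank_pos
  obtain ⟨c, hc⟩ := exists_ae_eq_sum_translationMatrix hV b ⟨0, hd⟩
  have h1 : (b ⟨0, hd⟩ : Lp ℂ 2 μ) =
      ContinuousMap.toLp 2 μ ℂ ((translationIrrep hV b hV0 hmin).coeff ⟨0, hd⟩ c) := by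
    refine Lp.ext (hc.trans ?_)
    exact (ContinuousMap.coeFn_toLp (p := 2) μ (𝕜 := ℂ)
      ((translationIrrep hV b hV0 hmin).coeff ⟨0, hd⟩ c)).symm
  have h2 := horth (translationIrrep hV b hV0 hmin) ⟨0, hd⟩ c _ (hVW (b ⟨0, hd⟩).2)
  rw [← h1, inner_self_eq_zero] at h2
  have h3 := b.orthonormal.ne_zero ⟨0, hd⟩
  exact h3 (Subtype.ext h2)

/-- The coefficients of equivalent representations span the same functions. -/
theorem UnitaryIrrep.exists_coeff_eq_sum {ξ η : UnitaryIrrep G} (h : η ≈ ξ) (i : Fin η.dim)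
    (v : Fin η.dim → ℂ) : ∃ (a : Fin ξ.dim → ℂ) (w : Fin ξ.dim → ℂ),
      η.coeff i v = ∑ l, a l • ξ.coeff l w := by
  obtain ⟨e, he⟩ := h
  -- From `η(x) v = e⁻¹ (ξ(x) (e v))`, expanded in the standard basis of the target of `e`.
  refine ⟨fun l => e.symm (Pi.single l 1) i, e v, ?_⟩
  ext x
  have h1 : (η.mat x).mulVec v = e.symm ((ξ.mat x).mulVec (e v)) := by
    rw [← he, e.symm_apply_apply]
  change (η.mat x).mulVec v i = _
  rw [h1, ContinuousMap.sum_apply]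
  conv_lhs => rw [pi_eq_sum_univ' ((ξ.mat x).mulVec (e v))]
  simp only [map_sum, map_smul, Finset.sum_apply, Pi.smul_apply, smul_eq_mul,
    ContinuousMap.smul_apply]
  refine Finset.sum_congr rfl fun l _ => ?_
  rw [mul_comm]
  rfl

end Invariant

/-! ### The Schatten norm of a positive operator with many orthonormal eigenvectors -/

section Eigenvectors

variable {H : Type*} [NormedAddCommGroup H] [InnerProductSpace ℂ H] [CompleteSpace H]

/-- An orthonormal family of eigenvectors of a positive compact operator, with no eigenvector of
nonzero eigenvalue orthogonal to it, computes the Schatten norm. -/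
theorem schattenOneNorm_eq_tsum_of_orthonormal {T : H →L[ℂ] H} (hpos : T.IsPositive)
    (hc : IsCompactOperator T) {ι : Type*} {e : ι → H} (he : Orthonormal ℂ e) {c : ι → ℝ≥0}
    (hTe : ∀ i, T (e i) = ((c i : ℝ) : ℂ) • e i)
    (hcomp : ∀ s : ℝ≥0, s ≠ 0 → ∀ f : H, T f = ((s : ℝ) : ℂ) • f →
      (∀ i, inner ℂ (e i) f = 0) → f = 0) :
    schattenOneNorm T = ∑' i, (c i : ℝ≥0∞) := by
  have habs : CFC.abs T = T :=
    CFC.abs_of_nonneg T ((ContinuousLinearMap.nonneg_iff_isPositive T).2 hpos)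
  rw [schattenOneNorm, habs, ← ENNReal.tsum_fiberwise (fun i => (c i : ℝ≥0∞)) c]
  refine tsum_congr fun s => ?_
  have h1 : ∑' b : c ⁻¹' {s}, (c b : ℝ≥0∞) = (c ⁻¹' {s}).encard * (s : ℝ≥0∞) := by
    rw [← ENNReal.tsum_set_const]
    exact tsum_congr fun b => by rw [show c b = s from b.2]
  rw [h1, mul_comm]
  -- The fibre and the eigenspace over `0` may be infinite; the weight `0` removes both, as `0 * ⊤ =
  -- 0`.
  rcases eq_or_ne s 0 with rfl | hs
  · simp
  congr 1
  have hs' : ((s : ℝ) : ℂ) ≠ 0 := by exact_mod_cast hs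
  set E := Module.End.eigenspace (T : H →ₗ[ℂ] H) ((s : ℝ) : ℂ) with hE
  have hfin : FiniteDimensional ℂ E := T.finite_dimensional_eigenspace hc _ hs'
  have hmem (f : H) : f ∈ E ↔ T f = ((s : ℝ) : ℂ) • f := Module.End.mem_eigenspace_iff
  have hli : LinearIndependent ℂ fun b : c ⁻¹' {s} => e b :=
    he.linearIndependent.comp _ Subtype.val_injective
  have heE (b : c ⁻¹' {s}) : e b ∈ E := by
    rw [hmem, hTe, show c b = s from b.2]
  have hfinite : Finite (c ⁻¹' {s}) := by
    have : LinearIndependent ℂ fun b : c ⁻¹' {s} => (⟨e b, heE b⟩ : E) :=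
      LinearIndependent.of_comp E.subtype hli
    exact this.finite
  have := Fintype.ofFinite (c ⁻¹' {s})
  have hle : Submodule.span ℂ (Set.range fun b : c ⁻¹' {s} => e b) ≤ E :=
    Submodule.span_le.2 (by rintro _ ⟨b, rfl⟩; exact heE b)
  have : FiniteDimensional ℂ (Submodule.span ℂ (Set.range fun b : c ⁻¹' {s} => e b)) :=
    Submodule.finiteDimensional_of_le hle
  -- A vector of the eigenspace orthogonal to this fibre is also orthogonal to every `e i` with
  -- another eigenvalue, by symmetry of `T`; hence `hcomp` kills it.
  have hEq : Submodule.span ℂ (Set.range fun b : c ⁻¹' {s} => e b) = E := by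
    have h2 := Submodule.sup_orthogonal_inf_of_hasOrthogonalProjection hle
    suffices h3 : (Submodule.span ℂ (Set.range fun b : c ⁻¹' {s} => e b))ᗮ ⊓ E = ⊥ by
      rwa [h3, sup_bot_eq] at h2
    refine (Submodule.eq_bot_iff _).2 fun f hf => ?_
    have hTf := (hmem f).1 hf.2
    refine hcomp s hs f hTf fun i => ?_
    by_cases hi : c i = s
    · exact (Submodule.mem_orthogonal _ _).1 hf.1 _ (Submodule.subset_span ⟨⟨i, hi⟩, rfl⟩)
    · have h4 : inner ℂ (T (e i)) f = inner ℂ (e i) (T f) := hpos.isSymmetric (e i) f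
      rw [hTe, hTf, inner_smul_left, inner_smul_right, Complex.conj_ofReal] at h4
      have h5 : (((c i : ℝ) : ℂ) - ((s : ℝ) : ℂ)) * inner ℂ (e i) f = 0 := by
        rw [sub_mul, h4, sub_self]
      refine (mul_eq_zero.1 h5).resolve_left (sub_ne_zero.2 fun h6 => hi ?_)
      exact_mod_cast h6
  rw [← hEq, finrank_span_eq_card hli, Set.encard_eq_coe_toFinset_card, Set.toFinset_card]
  rfl

end Eigenvectors

/-! ### The Schatten norm of a convolution operator -/

section Convolution

variable {G : Type*} [TopologicalSpace G] [Group G] [IsTopologicalGroup G] [CompactSpace G]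
  [T2Space G] [SecondCountableTopology G] [MeasurableSpace G] [BorelSpace G]
  {μ : Measure G} [μ.IsHaarMeasure] [IsProbabilityMeasure μ]

/-- An eigenfunction of a compact convolution operator, for a nonzero eigenvalue, that is
orthogonal to all coefficients is zero. -/
theorem eq_zero_of_eigenvector_of_orthogonal_coeff {T : Lp ℂ 2 μ →L[ℂ] Lp ℂ 2 μ}
    (hc : IsCompactOperator T) {k : G → ℂ}
    (hT : ∀ f : Lp ℂ 2 μ, T f =ᵐ[μ] fun x => ∫ y, k (y⁻¹ * x) * f y ∂μ) {s : ℂ} (hs : s ≠ 0)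
    {f : Lp ℂ 2 μ} (hf : T f = s • f)
    (horth : ∀ (ξ : UnitaryIrrep G) (i : Fin ξ.dim) (v : Fin ξ.dim → ℂ),
      inner ℂ (ContinuousMap.toLp 2 μ ℂ (ξ.coeff i v)) f = 0) : f = 0 := by
  let M : Submodule ℂ (Lp ℂ 2 μ) := Submodule.span ℂ
    {h | ∃ (ξ : UnitaryIrrep G) (i : Fin ξ.dim) (v : Fin ξ.dim → ℂ),
      h = ContinuousMap.toLp 2 μ ℂ (ξ.coeff i v)}
  have hM (h : Lp ℂ 2 μ) : h ∈ Mᗮ ↔ ∀ (ξ : UnitaryIrrep G) (i : Fin ξ.dim) (v : Fin ξ.dim → ℂ),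
      inner ℂ (ContinuousMap.toLp 2 μ ℂ (ξ.coeff i v)) h = 0 := by
    constructor
    · intro hh ξ i v
      exact (Submodule.mem_orthogonal _ _).1 hh _ (Submodule.subset_span ⟨ξ, i, v, rfl⟩)
    · intro hh
      refine (Submodule.mem_orthogonal _ _).2 fun u hu => ?_
      induction hu using Submodule.span_induction with
      | mem x hx => obtain ⟨ξ, i, v, rfl⟩ := hx; exact hh ξ i v
      | zero => exact inner_zero_left _
      | add x y _ _ hx hy => rw [inner_add_left, hx, hy, add_zero]
      | smul a x _ hx => rw [inner_smul_left, hx, mul_zero]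
  let E := Module.End.eigenspace (T : Lp ℂ 2 μ →ₗ[ℂ] Lp ℂ 2 μ) s
  have hE (h : Lp ℂ 2 μ) : h ∈ E ↔ T h = s • h := Module.End.mem_eigenspace_iff
  have : FiniteDimensional ℂ E := T.finite_dimensional_eigenspace hc s hs
  have : FiniteDimensional ℂ (E ⊓ Mᗮ : Submodule ℂ (Lp ℂ 2 μ)) :=
    Submodule.finiteDimensional_of_le inf_le_left
  -- `E` is invariant because `T` commutes with translations, and `Mᗮ` because a translate of a
  -- coefficient is a combination of coefficients.
  have hinv : IsTranslationInvariant (E ⊓ Mᗮ) := by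
    intro g h hh
    refine ⟨(hE _).2 ?_, (hM _).2 fun ξ i v => ?_⟩
    · rw [convolution_leftTranslation hT, (hE h).1 hh.1, map_smul]
    · have h1 := inner_leftTranslation_left g⁻¹ (ContinuousMap.toLp 2 μ ℂ (ξ.coeff i v)) h
      rw [inv_inv] at h1
      rw [← h1, leftTranslation_toLp_coeff, sum_inner]
      refine Finset.sum_eq_zero fun l _ => ?_
      rw [inner_smul_left, (hM h).1 hh.2, mul_zero]
  have hbot := hinv.eq_bot_of_orthogonal_coeff fun ξ i v h hh => (hM h).1 hh.2 ξ i v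
  have hmem : f ∈ E ⊓ Mᗮ := ⟨(hE f).2 hf, (hM f).2 horth⟩
  rwa [hbot, Submodule.mem_bot] at hmem

/-- The Schatten norm of a positive compact convolution operator, in terms of its symbol. -/
theorem schattenOneNorm_convolution (rep : UnitaryDual G → UnitaryIrrep G)
    (hrep : ∀ ξ : UnitaryDual G, Quotient.mk (UnitaryIrrep.setoid G) (rep ξ) = ξ)
    {T : Lp ℂ 2 μ →L[ℂ] Lp ℂ 2 μ} (hpos : T.IsPositive) (hc : IsCompactOperator T)
    {k : G → ℂ} (hk : MemLp k 2 μ)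
    (hT : ∀ f : Lp ℂ 2 μ, T f =ᵐ[μ] fun x => ∫ y, k (y⁻¹ * x) * f y ∂μ) :
    schattenOneNorm T = ∑' ξ : UnitaryDual G,
      ENNReal.ofReal ((rep ξ).dim * (groupFourierCoeff μ k (rep ξ)).trace.re) := by
  classical
  have hpsd (ξ : UnitaryDual G) := posSemidef_groupFourierCoeff hpos hk hT (rep ξ)
  let v (ξ : UnitaryDual G) (j : Fin (rep ξ).dim) : Fin (rep ξ).dim → ℂ :=
    ((hpsd ξ).isHermitian.eigenvectorBasis j).ofLp
  have hv (ξ : UnitaryDual G) (i j : Fin (rep ξ).dim) :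
      star (v ξ i) ⬝ᵥ v ξ j = if i = j then 1 else 0 := by
    rw [← (hpsd ξ).isHermitian.eigenvectorBasis.inner_eq_ite,
      EuclideanSpace.inner_eq_star_dotProduct, dotProduct_comm]
  let c (p : Σ ξ : UnitaryDual G, Fin (rep ξ).dim × Fin (rep ξ).dim) : ℝ≥0 :=
    ⟨(hpsd p.1).isHermitian.eigenvalues p.2.2, (hpsd p.1).eigenvalues_nonneg _⟩
  -- The factor `√d` offsets the squared norm `1/d` given by Schur orthogonality. The row `p.2.1` is
  -- free, while the eigenvalue depends only on `p.2.2`, whence the multiplicity `d`.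
  let e (p : Σ ξ : UnitaryDual G, Fin (rep ξ).dim × Fin (rep ξ).dim) : Lp ℂ 2 μ :=
    ((Real.sqrt (rep p.1).dim : ℝ) : ℂ) •
      ContinuousMap.toLp 2 μ ℂ ((rep p.1).coeff p.2.1 (v p.1 p.2.2))
  have hsqrt (ξ : UnitaryDual G) : ((Real.sqrt (rep ξ).dim : ℝ) : ℂ) ≠ 0 := by
    exact_mod_cast (Real.sqrt_pos.2 (by exact_mod_cast (rep ξ).dim_pos)).ne'
  have he : Orthonormal ℂ e := by
    rw [orthonormal_iff_ite]
    rintro ⟨ξ, i, j⟩ ⟨η, l, m⟩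
    simp only [e, inner_smul_left, inner_smul_right, Complex.conj_ofReal]
    by_cases h : ξ = η
    · subst h
      rw [UnitaryIrrep.inner_coeff_self, hv]
      have hsq : ((Real.sqrt (rep ξ).dim : ℝ) : ℂ) * ((Real.sqrt (rep ξ).dim : ℝ) : ℂ) =
          (rep ξ).dim := by
        rw [← Complex.ofReal_mul, Real.mul_self_sqrt (Nat.cast_nonneg _), Complex.ofReal_natCast]
      have hd : ((rep ξ).dim : ℂ) ≠ 0 := by exact_mod_cast (rep ξ).dim_pos.ne'
      by_cases h1 : i = l
      · by_cases h2 : j = m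
        · subst h1 h2
          simp only [if_true]
          rw [← mul_assoc, hsq, mul_one_div_cancel hd]
        · simp [h2]
      · simp [h1]
    · rw [UnitaryIrrep.inner_coeff_of_not_equiv, mul_zero, mul_zero, if_neg]
      · exact fun h1 => h (congrArg Sigma.fst h1)
      · intro h1
        have := Quotient.sound (s := UnitaryIrrep.setoid G) h1
        rw [hrep, hrep] at this
        exact h this.symm
  have hTe (p) : T (e p) = ((c p : ℝ) : ℂ) • e p := by
    have h1 : (groupFourierCoeff μ k (rep p.1)).mulVec (v p.1 p.2.2) =
        ((c p : ℝ) : ℂ) • v p.1 p.2.2 :=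
      (hpsd p.1).isHermitian.mulVec_eigenvectorBasis p.2.2
    simp only [e]
    rw [map_smul, convolution_apply_coeff hk hT, h1, UnitaryIrrep.coeff_smul, map_smul, smul_comm]
  have hcomp (s : ℝ≥0) (hs : s ≠ 0) (f : Lp ℂ 2 μ) (hf : T f = ((s : ℝ) : ℂ) • f)
      (hfe : ∀ p, inner ℂ (e p) f = 0) : f = 0 := by
    refine eq_zero_of_eigenvector_of_orthogonal_coeff hc hT
      (by exact_mod_cast hs) hf fun η i w => ?_
    have h1 (ξ : UnitaryDual G) (l j : Fin (rep ξ).dim) :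
        inner ℂ (ContinuousMap.toLp 2 μ ℂ ((rep ξ).coeff l (v ξ j))) f = 0 := by
      have := hfe ⟨ξ, l, j⟩
      simp only [e, inner_smul_left, Complex.conj_ofReal] at this
      exact (mul_eq_zero.1 this).resolve_left (hsqrt ξ)
    -- The eigenvectors span `ℂ^d`, so orthogonality extends to all coefficients of the
    -- representatives, and then, through equivalence, to those of every irreducible representation.
    have h2 (ξ : UnitaryDual G) (l : Fin (rep ξ).dim) (u : Fin (rep ξ).dim → ℂ) :
        inner ℂ (ContinuousMap.toLp 2 μ ℂ ((rep ξ).coeff l u)) f = 0 := by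
      have h3 : u = ∑ j, ((hpsd ξ).isHermitian.eigenvectorBasis.repr (WithLp.toLp 2 u)).ofLp j •
          v ξ j := by
        have := congrArg WithLp.ofLp
          ((hpsd ξ).isHermitian.eigenvectorBasis.sum_repr (WithLp.toLp 2 u))
        simpa using this.symm
      rw [h3, UnitaryIrrep.coeff_sum_smul, map_sum, sum_inner]
      refine Finset.sum_eq_zero fun j _ => ?_
      rw [map_smul, inner_smul_left, h1, mul_zero]
    obtain ⟨a, u, hau⟩ := UnitaryIrrep.exists_coeff_eq_sum (Quotient.exact (hrep ⟦η⟧).symm) i w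
    rw [hau, map_sum, sum_inner]
    refine Finset.sum_eq_zero fun l _ => ?_
    rw [map_smul, inner_smul_left, h2, mul_zero]
  rw [schattenOneNorm_eq_tsum_of_orthonormal hpos hc he hTe hcomp, ENNReal.tsum_sigma']
  refine tsum_congr fun ξ => ?_
  have htr : (groupFourierCoeff μ k (rep ξ)).trace.re =
      ∑ j, (hpsd ξ).isHermitian.eigenvalues j := by
    rw [(hpsd ξ).isHermitian.trace_eq_sum_eigenvalues]
    simp
  rw [tsum_fintype, Fintype.sum_prod_type, htr, ENNReal.ofReal_mul (Nat.cast_nonneg _),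
    ENNReal.ofReal_sum_of_nonneg fun j _ => (hpsd ξ).eigenvalues_nonneg j]
  have hcx (i j : Fin (rep ξ).dim) : (c ⟨ξ, i, j⟩ : ℝ≥0∞) =
      ENNReal.ofReal ((hpsd ξ).isHermitian.eigenvalues j) :=
    (ENNReal.ofReal_eq_coe_nnreal ((hpsd ξ).eigenvalues_nonneg j)).symm
  simp only [hcx, Finset.sum_const, Finset.card_univ, Fintype.card_fin, nsmul_eq_mul,
    ENNReal.ofReal_natCast]

end Convolution

/-! ### Hilbert–Schmidt estimates -/

section HilbertSchmidt

variable {d : ℕ}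

theorem trace_mul_conjTranspose_self (A : Matrix (Fin d) (Fin d) ℂ) :
    (A * A.conjTranspose).trace = ((∑ i, ∑ j, ‖A i j‖ ^ 2 : ℝ) : ℂ) := by
  simp only [Matrix.trace, Matrix.diag, Matrix.mul_apply, Matrix.conjTranspose_apply,
    Complex.ofReal_sum, Complex.ofReal_pow]
  exact Finset.sum_congr rfl fun i _ => Finset.sum_congr rfl fun j _ => Complex.mul_conj' _

theorem HSBlock.norm_sq_eq_trace (A : HSBlock d) :
    ((‖A‖ ^ 2 : ℝ) : ℂ) = d * (HSBlock.mat A * (HSBlock.mat A).conjTranspose).trace := by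
  rw [trace_mul_conjTranspose_self, HSBlock.norm_sq, Complex.ofReal_mul, Complex.ofReal_natCast]

theorem sum_norm_sq_mul_unitary (A U : Matrix (Fin d) (Fin d) ℂ) (hU : U * U.conjTranspose = 1) :
    ∑ i, ∑ j, ‖(A * U) i j‖ ^ 2 = ∑ i, ∑ j, ‖A i j‖ ^ 2 := by
  have h : (((∑ i, ∑ j, ‖(A * U) i j‖ ^ 2 : ℝ)) : ℂ) = ((∑ i, ∑ j, ‖A i j‖ ^ 2 : ℝ) : ℂ) := by
    rw [← trace_mul_conjTranspose_self, ← trace_mul_conjTranspose_self, Matrix.conjTranspose_mul,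
      Matrix.mul_assoc, ← Matrix.mul_assoc U, hU, Matrix.one_mul]
  exact_mod_cast h

theorem norm_trace_mul_sq_le (A B : Matrix (Fin d) (Fin d) ℂ) :
    ‖(A * B).trace‖ ^ 2 ≤ (∑ i, ∑ j, ‖A i j‖ ^ 2) * ∑ i, ∑ j, ‖B i j‖ ^ 2 := by
  have h1 : ‖(A * B).trace‖ ≤ ∑ p : Fin d × Fin d, ‖A p.1 p.2‖ * ‖B p.2 p.1‖ := by
    rw [Fintype.sum_prod_type]
    simp only [Matrix.trace, Matrix.diag, Matrix.mul_apply]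
    refine (norm_sum_le _ _).trans (Finset.sum_le_sum fun i _ => ?_)
    exact (norm_sum_le _ _).trans (Finset.sum_le_sum fun j _ => (norm_mul _ _).le)
  refine (pow_le_pow_left₀ (norm_nonneg _) h1 2).trans ?_
  refine (Finset.sum_mul_sq_le_sq_mul_sq _ _ _).trans_eq ?_
  rw [Fintype.sum_prod_type, Fintype.sum_prod_type, Finset.sum_comm (f := fun i j => ‖B i j‖ ^ 2)]

/-- Cauchy–Schwarz for the Hilbert–Schmidt product, with `U` absorbed into `B`; the factor `d`
splits as `√d · √d` between the two block norms. -/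
theorem HSBlock.norm_dim_mul_trace_le (A B : HSBlock d) (U : Matrix (Fin d) (Fin d) ℂ)
    (hU : U * U.conjTranspose = 1) :
    ‖(d : ℂ) * (HSBlock.mat A * HSBlock.mat B * U).trace‖ ≤ ‖A‖ * ‖B‖ := by
  refine (pow_le_pow_iff_left₀ (norm_nonneg _) (by positivity) two_ne_zero).1 ?_
  rw [norm_mul, mul_pow, mul_pow, HSBlock.norm_sq, HSBlock.norm_sq, Complex.norm_natCast,
    Matrix.mul_assoc, ← sum_norm_sq_mul_unitary (HSBlock.mat B) U hU]
  calc (d : ℝ) ^ 2 * ‖(HSBlock.mat A * (HSBlock.mat B * U)).trace‖ ^ 2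
      ≤ (d : ℝ) ^ 2 * ((∑ i, ∑ j, ‖HSBlock.mat A i j‖ ^ 2) *
          ∑ i, ∑ j, ‖(HSBlock.mat B * U) i j‖ ^ 2) := by
        gcongr; exact norm_trace_mul_sq_le _ _
    _ = _ := by ring

end HilbertSchmidt

/-! ### The synthesis operator of an element of `ℓ²(Ĝ)` -/

section Synthesis

variable {G : Type*} [Group G] [TopologicalSpace G] [CompactSpace G]
  {rep : UnitaryDual G → UnitaryIrrep G}

/-- The function `x ↦ d_ξ Tr[h(ξ) C(ξ) ξ(x)]`. -/
noncomputable def synthesisTerm (h C : EllTwoDual rep) (ξ : UnitaryDual G) : C(G, ℂ) where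
  toFun x := ((rep ξ).dim : ℂ) *
    (HSBlock.mat (h ξ) * HSBlock.mat (C ξ) * (rep ξ).mat x).trace
  continuous_toFun :=
    continuous_const.mul (continuous_const.matrix_mul (rep ξ).continuous_mat).matrix_trace

theorem synthesisTerm_apply (h C : EllTwoDual rep) (ξ : UnitaryDual G) (x : G) :
    synthesisTerm h C ξ x = ((rep ξ).dim : ℂ) *
      (HSBlock.mat (h ξ) * HSBlock.mat (C ξ) * (rep ξ).mat x).trace := rfl

theorem norm_synthesisTerm_le (h C : EllTwoDual rep) (ξ : UnitaryDual G) :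
    ‖synthesisTerm h C ξ‖ ≤ ‖h ξ‖ * ‖C ξ‖ :=
  (ContinuousMap.norm_le _ (by positivity)).2 fun x =>
    HSBlock.norm_dim_mul_trace_le _ _ _ ((rep ξ).mat_mul_conjTranspose x)

theorem EllTwoDual.hasSum_norm_sq (h : EllTwoDual rep) :
    HasSum (fun ξ => ‖h ξ‖ ^ 2) (‖h‖ ^ 2) := by
  simpa using lp.hasSum_norm (p := 2) (by norm_num) h

theorem exists_hasSum_norm_mul_norm (h C : EllTwoDual rep) :
    ∃ a ≤ ‖h‖ * ‖C‖, HasSum (fun ξ => ‖h ξ‖ * ‖C ξ‖) a := by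
  obtain ⟨a, -, ha, hs⟩ := Real.inner_le_Lp_mul_Lq_hasSum_of_nonneg
    (f := fun ξ => ‖h ξ‖) (g := fun ξ => ‖C ξ‖) Real.HolderConjugate.two_two
    (norm_nonneg h) (norm_nonneg C) (fun _ => norm_nonneg _) (fun _ => norm_nonneg _)
    (by simpa using EllTwoDual.hasSum_norm_sq h) (by simpa using EllTwoDual.hasSum_norm_sq C)
  exact ⟨a, ha, hs⟩

/-- The terms are absolutely summable in the supremum norm, so the sum is continuous and the
convergence at each point is unconditional. -/
theorem summable_synthesisTerm (h C : EllTwoDual rep) : Summable (synthesisTerm h C) := by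
  obtain ⟨a, -, hs⟩ := exists_hasSum_norm_mul_norm h C
  exact Summable.of_norm_bounded hs.summable (norm_synthesisTerm_le h C)

/-- The operator `C ↦ 𝔉⁻¹[h C]` from `ℓ²(Ĝ)` to `C(G)`. -/
noncomputable def synthesis (h : EllTwoDual rep) : EllTwoDual rep →L[ℂ] C(G, ℂ) :=
  LinearMap.mkContinuous
    { toFun := fun C => ∑' ξ, synthesisTerm h C ξ
      map_add' := fun C D => by
        rw [← (summable_synthesisTerm h C).tsum_add (summable_synthesisTerm h D)]
        refine tsum_congr fun ξ => ?_
        ext x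
        have e : (C + D) ξ = C ξ + D ξ := rfl
        simp only [synthesisTerm_apply, ContinuousMap.add_apply, e, map_add,
          Matrix.add_mul, Matrix.trace_add, mul_add]
      map_smul' := fun c C => by
        rw [RingHom.id_apply, ← (summable_synthesisTerm h C).tsum_const_smul c]
        refine tsum_congr fun ξ => ?_
        ext x
        have e : (c • C) ξ = c • C ξ := rfl
        simp only [synthesisTerm_apply, ContinuousMap.smul_apply, e, map_smul, Matrix.mul_smul,
          Matrix.smul_mul, Matrix.trace_smul, smul_eq_mul]
        ring }
    ‖h‖ fun C => by
      obtain ⟨a, ha, hs⟩ := exists_hasSum_norm_mul_norm h C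
      exact (tsum_of_norm_bounded hs (norm_synthesisTerm_le h C)).trans ha

theorem hasSum_synthesis (h C : EllTwoDual rep) (x : G) :
    HasSum (fun ξ => ((rep ξ).dim : ℂ) *
      (HSBlock.mat (h ξ) * HSBlock.mat (C ξ) * (rep ξ).mat x).trace) (synthesis h C x) :=
  ContinuousMap.hasSum_apply (summable_synthesisTerm h C).hasSum x

theorem norm_synthesis {h : EllTwoDual rep} (hh : ∀ ξ, (HSBlock.mat (h ξ)).IsHermitian) :
    ‖synthesis h‖ = ‖h‖ := by
  refine le_antisymm (LinearMap.mkContinuous_norm_le _ (norm_nonneg h) _) ?_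
  -- The extremal choice is `C = h` at the identity: with `h(ξ)` Hermitian, each term is `d Tr[h(ξ)
  -- h(ξ)^*] = ‖h(ξ)‖²`.
  have h1 : synthesis h h 1 = ((‖h‖ ^ 2 : ℝ) : ℂ) := by
    refine (hasSum_synthesis h h 1).unique ?_
    convert Complex.hasSum_ofReal.2 (EllTwoDual.hasSum_norm_sq h) using 2 with ξ
    rw [HSBlock.norm_sq_eq_trace, (hh ξ).eq, UnitaryIrrep.mat_one, Matrix.mul_one]
  have h3 : ‖h‖ ^ 2 ≤ ‖synthesis h‖ * ‖h‖ := by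
    calc ‖h‖ ^ 2 = ‖synthesis h h 1‖ := by
          rw [h1, Complex.norm_real, Real.norm_of_nonneg (by positivity)]
      _ ≤ ‖synthesis h h‖ := ContinuousMap.norm_coe_le_norm _ _
      _ ≤ _ := (synthesis h).le_opNorm h
  rcases (norm_nonneg h).eq_or_lt with h0 | h0
  · rw [← h0]; exact norm_nonneg _
  · rw [sq] at h3
    exact le_of_mul_le_mul_right h3 h0

/-- Each term is bilinear in the two blocks at the same `ξ`, so it does not matter which of them is
cut off. The norm formula then applies to the truncated `h`. -/
theorem synthesis_comp_multiplierProj (h : EllTwoDual rep) (A : Set (UnitaryDual G)) :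
    synthesis h ∘L multiplierProj rep A = synthesis (multiplierProj rep A h) := by
  ext C x
  refine (hasSum_synthesis h (multiplierProj rep A C) x).unique ?_
  convert hasSum_synthesis (multiplierProj rep A h) C x using 3 with ξ
  rw [multiplierProj_apply, multiplierProj_apply]
  split_ifs <;> simp

theorem norm_synthesis_comp_multiplierProj {h : EllTwoDual rep}
    (hh : ∀ ξ, (HSBlock.mat (h ξ)).IsHermitian) (A : Set (UnitaryDual G)) :
    ‖synthesis h ∘L multiplierProj rep A‖ = ‖multiplierProj rep A h‖ := by
  rw [synthesis_comp_multiplierProj]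
  refine norm_synthesis fun ξ => ?_
  rw [multiplierProj_apply]
  split_ifs
  · exact hh ξ
  · rw [map_zero]; exact Matrix.isHermitian_zero

theorem hasSum_indicator_norm_sq (h : EllTwoDual rep) (A : Set (UnitaryDual G)) :
    HasSum (A.indicator fun ξ => ‖h ξ‖ ^ 2) (‖multiplierProj rep A h‖ ^ 2) := by
  classical
  convert EllTwoDual.hasSum_norm_sq (multiplierProj rep A h) using 2 with ξ
  rw [multiplierProj_apply, Set.indicator_apply]
  split_ifs <;> simp

end Synthesis

/-! ### Matrix square roots and the theorem. -/

open scoped MatrixOrder in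
theorem Matrix.PosSemidef.exists_posSemidef_mul_self_eq {d : ℕ} {A : Matrix (Fin d) (Fin d) ℂ}
    (hA : A.PosSemidef) : ∃ H : Matrix (Fin d) (Fin d) ℂ, H.PosSemidef ∧ H * H = A :=
  ⟨CFC.sqrt A, Matrix.nonneg_iff_posSemidef.1 (CFC.sqrt_nonneg A),
    CFC.sqrt_mul_sqrt_self A hA.nonneg⟩

theorem lemma5p1 {n : ℕ} {G : Type*} [TopologicalSpace G]
    [ChartedSpace (EuclideanSpace ℝ (Fin n)) G] [Group G] [LieGroup (𝓡 n) ∞ G]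
    [CompactSpace G] [T2Space G] [MeasurableSpace G] [BorelSpace G]
    (μ : Measure G) [μ.IsHaarMeasure] [IsProbabilityMeasure μ]
    (rep : UnitaryDual G → UnitaryIrrep G)
    (hrep : ∀ ξ : UnitaryDual G, Quotient.mk (UnitaryIrrep.setoid G) (rep ξ) = ξ)
    (T : Lp ℂ 2 μ →L[ℂ] Lp ℂ 2 μ) (hT : IsTraceClassOp T)
    (k : G → ℂ) (hk : MemLp k 2 μ)
    (K : G → G → ℂ) (hKk : ∀ x y, K x y = k (y⁻¹ * x))
    (hTK : ∀ f : Lp ℂ 2 μ, T f =ᵐ[μ] fun x => ∫ y, K x y * f y ∂μ)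
    (hpos : IsPosDefKernel K) (hsymm : IsSymmKernel μ K)
    (σ : ∀ ξ : UnitaryDual G, Matrix (Fin (rep ξ).dim) (Fin (rep ξ).dim) ℂ)
    (hσ : ∀ ξ, σ ξ = groupFourierCoeff μ k (rep ξ)) :
    ∃ H : ∀ ξ : UnitaryDual G, Matrix (Fin (rep ξ).dim) (Fin (rep ξ).dim) ℂ,
      (∀ ξ, (H ξ).PosSemidef ∧ H ξ * H ξ = σ ξ) ∧
      ∃ Q : EllTwoDual rep →L[ℂ] C(G, ℂ),
        (∀ (C : EllTwoDual rep) (x : G),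
          HasSum (fun ξ => ((rep ξ).dim : ℂ) *
            (H ξ * HSBlock.mat (C ξ) * (rep ξ).mat x).trace) (Q C x)) ∧
        HasSum (fun ξ => ((rep ξ).dim : ℂ) * (σ ξ).trace) ((‖Q‖ ^ 2 : ℝ) : ℂ) ∧
        ENNReal.ofReal (‖Q‖ ^ 2) = schattenOneNorm T ∧
        ∀ A : Finset (UnitaryDual G),
          ((‖Q ∘L multiplierProj rep (A : Set (UnitaryDual G))‖ ^ 2 : ℝ) : ℂ) =
            ∑ ξ ∈ A, ((rep ξ).dim : ℂ) * (σ ξ).trace ∧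
          HasSum (fun ξ : {ξ : UnitaryDual G // ξ ∉ A} =>
            ((rep ξ.1).dim : ℂ) * (σ ξ.1).trace)
            ((‖Q ∘L multiplierProj rep ((A : Set (UnitaryDual G))ᶜ)‖ ^ 2 : ℝ) : ℂ) := by
  have := topologicalGroup_of_lieGroup (𝓡 n) ∞ (G := G)
  -- A compact manifold is second countable, as the earlier lemmas on `μ.prod μ` and on translations
  -- require.
  have := ChartedSpace.secondCountable_of_sigmaCompact (EuclideanSpace ℝ (Fin n)) G
  obtain rfl : K = fun x y => k (y⁻¹ * x) := funext₂ hKk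
  obtain rfl : σ = fun ξ => groupFourierCoeff μ k (rep ξ) := funext hσ
  have hTpos : T.IsPositive := isPositive_of_isPosDefKernel T hk hTK hpos
  have hS := schattenOneNorm_convolution rep hrep hTpos hT.1 hk hTK
  choose H hH using fun ξ =>
    (posSemidef_groupFourierCoeff hTpos hk hTK (rep ξ)).exists_posSemidef_mul_self_eq
  have hnorm (ξ : UnitaryDual G) : ((‖(HSBlock.mat.symm (H ξ) : HSBlock (rep ξ).dim)‖ ^ 2 : ℝ) : ℂ) =
      ((rep ξ).dim : ℂ) * (groupFourierCoeff μ k (rep ξ)).trace := by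
    rw [HSBlock.norm_sq_eq_trace, LinearEquiv.apply_symm_apply, (hH ξ).1.isHermitian.eq, (hH ξ).2]
  have hre (ξ : UnitaryDual G) : ‖(HSBlock.mat.symm (H ξ) : HSBlock (rep ξ).dim)‖ ^ 2 =
      (rep ξ).dim * (groupFourierCoeff μ k (rep ξ)).trace.re := by
    rw [← Complex.ofReal_re (_ ^ 2), hnorm, ← Complex.ofReal_natCast, Complex.re_ofReal_mul]
  simp_rw [← hre] at hS
  -- This is where the trace class hypothesis enters: the sum of the squared block norms is
  -- `schattenOneNorm T`, so its finiteness places `H` in `ℓ²(Ĝ)`.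
  have hsum : Summable fun ξ => ‖(HSBlock.mat.symm (H ξ) : HSBlock (rep ξ).dim)‖ ^ 2 :=
    (ENNReal.summable_toReal (hS ▸ hT.2.ne)).congr fun ξ =>
      ENNReal.toReal_ofReal (by positivity)
  let h : EllTwoDual rep := ⟨fun ξ => HSBlock.mat.symm (H ξ), memℓp_gen (by simpa using hsum)⟩
  have hmat (ξ : UnitaryDual G) : HSBlock.mat (h ξ) = H ξ := rfl
  have hherm (ξ : UnitaryDual G) : (HSBlock.mat (h ξ)).IsHermitian := (hH ξ).1.isHermitian
  have hn (ξ : UnitaryDual G) : ((rep ξ).dim : ℂ) * (groupFourierCoeff μ k (rep ξ)).trace =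
      ((‖h ξ‖ ^ 2 : ℝ) : ℂ) := (hnorm ξ).symm
  have htot := EllTwoDual.hasSum_norm_sq h
  refine ⟨H, hH, synthesis h, hasSum_synthesis h, ?_, ?_, fun A => ⟨?_, ?_⟩⟩
  · simp only [hn]
    rw [norm_synthesis hherm]
    exact Complex.hasSum_ofReal.2 htot
  · rw [hS, norm_synthesis hherm, ← htot.tsum_eq,
      ENNReal.ofReal_tsum_of_nonneg (fun ξ => by positivity) htot.summable]
  · simp only [hn]
    rw [norm_synthesis_comp_multiplierProj hherm, ← Complex.ofReal_sum]
    congr 1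
    refine (hasSum_indicator_norm_sq h _).unique ?_
    have := hasSum_sum_of_ne_finset_zero (L := .unconditional _) (f := (A : Set (UnitaryDual G)).indicator
      fun ξ => ‖h ξ‖ ^ 2) (s := A) fun ξ hξ => Set.indicator_of_notMem (by simpa using hξ) _
    rwa [Finset.sum_congr rfl fun ξ hξ =>
      Set.indicator_of_mem (Finset.mem_coe.2 hξ) (fun ξ => ‖h ξ‖ ^ 2)] at this
  · simp only [hn]
    rw [norm_synthesis_comp_multiplierProj hherm]
    exact Complex.hasSum_ofReal.2
      (hasSum_subtype_iff_indicator.2 (hasSum_indicator_norm_sq h (A : Set (UnitaryDual G))ᶜ))
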